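/- Let $(E,m)$ and $(E_\partial,m_\partial)$ be $\sigma$-finite measure spaces, $L^1=L^1(E,m)$, $L^1_\partial=L^1(E_\partial,m_\partial)$ (real spaces), let $\mathcal D\subseteq L^1$ be a linear subspace and let $A,B\colon\mathcal D\to L^1$, $\Psi_0,\Psi\colon\mathcal D\to L^1_\partial$ be linear with $B,\Psi_0,\Psi$ positive; if $\Psi_0=0$, assume that also $\Psi=0$. A (sub)stochastic semigroup is a $C_0$-semigroup $\{P(t)\}_{t\ge0}$ on $L^1$ such that $P(t)f\ge 0$ and $\|P(t)f\|\le\|f\|$ (respectively $\|P(t)f\|=\|f\|$) for all $t\ge0$ and $0\le f\in L^1$. Assume: (i) the restriction $A_0$ of $A$ to $\mathcal D(A_0)=\{f\in\mathcal D:\Psi_0f=0\}$ is the generator of a substochastic semigroup on $L^1$; (ii) if $\Psi_0\neq0$, then for each $\lambda>0$ there is a positive linear operator $\Psi(\lambda)\colon L^1_\partial\to\operatorname{Ker}(\lambda-A)=\{f\in\mathcal D:\lambda f-Af=0\}$ with $\Psi_0\Psi(\lambda)f_\partial=f_\partial$ for all $f_\partial\in L^1_\partial$ (it is unique; if $\Psi_0=0$,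 put $\Psi(\lambda)=0$); (iii) $\displaystyle\int_E(Af+Bf)\,dm+\int_{E_\partial}(\Psi f-\Psi_0f)\,dm_\partial=0$ for all $f\in\mathcal D$, $f\ge0$. Let $A_\Psi$ be the restriction of $A$ to $\mathcal D(A_\Psi)=\{f\in\mathcal D:\Psi_0f=\Psi f\}$. On $L^1\times L^1_\partial$ with norm $\|(f,f_\partial)\|=\|f\|+\|f_\partial\|$ put $\mathcal A(f,0)=(Af,-\Psi_0f)$ and $\mathcal B(f,0)=(Bf,\Psi f)$ for $f\in\mathcal D$. Write $R(\lambda,T)=(\lambda-T)^{-1}$; when $\Psi_0=\Psi=0$, $R(\lambda,\mathcal A)$ is the inverse of $\lambda-\mathcal A$ defined on its range $L^1\times\{0\}$. Then there is a substochastic semigroup $\{P(t)\}_{t\ge0}$ on $L^1$ whose generator $G$ extends $(A_\Psi+B,\mathcal D(A_\Psi))$ and whose resolvent is given, for every $\lambda>0$ and $f\in L^1$, by $$R(\lambda,G)f=\lim_{N\to\infty}\sum_{n=0}^N\big(R(\lambda,A_0)B+\Psi(\lambda)\Psi\big)^nR(\lambda,A_0)f ,$$ and for this semigroup the following hold. (a)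 $\{P(t)\}_{t\ge0}$ is stochastic if and only if there is $\lambda>0$ such that $$\lim_{n\to\infty}\big\|(\mathcal BR(\lambda,\mathcal A))^n(f,0)\big\|=0\quad\text{for all } f\in L^1,\ f\ge0 .$$ (b) If for some $\lambda>0$ both $\lim_{n\to\infty}\|(\Psi\Psi(\lambda))^n\|=0$ and $\lim_{n\to\infty}\|(BR(\lambda,A_\Psi))^n\|=0$ (operator norms; the first condition implies that $\lambda$ is in the resolvent set of $A_\Psi$), then $\{P(t)\}_{t\ge0}$ is stochastic and its generator is exactly $(A_\Psi+B,\mathcal D(A_\Psi))$. -/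

import Mathlib

open MeasureTheory Filter Topology
open scoped NNReal

noncomputable section

namespace KatoGreiner

/-! ### Partially defined linear operators -/

section Operators

variable {X Y Z : Type*} [AddCommGroup X] [Module ℝ X] [AddCommGroup Y] [Module ℝ Y]
  [AddCommGroup Z] [Module ℝ Z]

/-- The operator `lam - T : D(T) → X`. -/
def shift (T : X →ₗ.[ℝ] X) (lam : ℝ) : T.domain →ₗ[ℝ] X :=
  lam • T.domain.subtype - T.toFun

/-- The resolvent `R(lam, T) = (lam - T)⁻¹`, as a map into `D(T)`. If `lam - T` is bijective this is
its inverse. If `lam - T` is merely injective, it is a linear map which coincides with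
`(lam - T)⁻¹` on the range of `lam - T` (and is unspecified elsewhere). -/
def resolvent (T : X →ₗ.[ℝ] X) (lam : ℝ) : X →ₗ[ℝ] T.domain :=
  (shift T lam).leftInverse

/-- For injective `lam - T` the operator `R(lam, T)` inverts `lam - T` on its range. -/
theorem resolvent_shift (T : X →ₗ.[ℝ] X) (lam : ℝ) (h : Function.Injective (shift T lam))
    (x : T.domain) : resolvent T lam (shift T lam x) = x :=
  LinearMap.leftInverse_apply_of_inj (LinearMap.ker_eq_bot.2 h) x

/-- For bijective `lam - T` the operator `R(lam, T)` is also a right inverse of `lam - T`. -/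
theorem shift_resolvent (T : X →ₗ.[ℝ] X) (lam : ℝ) (h : Function.Bijective (shift T lam))
    (y : X) : shift T lam (resolvent T lam y) = y := by
  obtain ⟨x, rfl⟩ := h.2 y
  rw [resolvent_shift T lam h.1]

/-- The restriction of `T` to `{f ∈ D(T) : Φ f = 0}`. -/
def restrictKer (T : X →ₗ.[ℝ] Y) (Φ : T.domain →ₗ[ℝ] Z) : X →ₗ.[ℝ] Y :=
  T.domRestrict ((LinearMap.ker Φ).map T.domain.subtype)

theorem restrictKer_domain_le (T : X →ₗ.[ℝ] Y) (Φ : T.domain →ₗ[ℝ] Z) :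
    (restrictKer T Φ).domain ≤ T.domain :=
  inf_le_right

theorem mem_restrictKer_domain (T : X →ₗ.[ℝ] Y) (Φ : T.domain →ₗ[ℝ] Z) (f : X) :
    f ∈ (restrictKer T Φ).domain ↔ ∃ h : f ∈ T.domain, Φ ⟨f, h⟩ = 0 := by
  simp [restrictKer]

/-- The inclusion of `{f ∈ D(T) : Φ f = 0}` into `D(T)`. -/
def inclKer (T : X →ₗ.[ℝ] Y) (Φ : T.domain →ₗ[ℝ] Z) :
    (restrictKer T Φ).domain →ₗ[ℝ] T.domain :=
  Submodule.inclusion (restrictKer_domain_le T Φ)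

/-- The sum `T + S` on `D(T)`, for a linear operator `S` defined on `D(T)`. -/
def addOn (T : X →ₗ.[ℝ] Y) (S : T.domain →ₗ[ℝ] Y) : X →ₗ.[ℝ] Y :=
  ⟨T.domain, T.toFun + S⟩

end Operators

/-- `lam` belongs to the resolvent set of `T`: the operator `lam - T` is one-to-one and onto, and
its inverse is bounded. -/
def InResolventSet {X : Type*} [NormedAddCommGroup X] [NormedSpace ℝ X]
    (T : X →ₗ.[ℝ] X) (lam : ℝ) : Prop :=
  Function.Bijective (shift T lam) ∧
    ∃ C : ℝ, ∀ y : X, ‖(resolvent T lam y : X)‖ ≤ C * ‖y‖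

/-- `‖Tⁿ‖ → 0` as `n → ∞` in the operator norm. -/
def PowersTendToZero {X : Type*} [NormedAddCommGroup X] [NormedSpace ℝ X]
    (T : Module.End ℝ X) : Prop :=
  ∀ ε : ℝ, 0 < ε → ∃ N : ℕ, ∀ n : ℕ, N ≤ n → ∀ x : X, ‖(T ^ n) x‖ ≤ ε * ‖x‖

/-! ### Substochastic and stochastic semigroups on `L¹` -/

/-- The space `L¹(E, m)` of real integrable functions. -/
abbrev L1 {E : Type*} [MeasurableSpace E] (m : Measure E) : Type _ := Lp ℝ 1 m

section Semigroups

variable {E : Type*} [MeasurableSpace E] {m : Measure E}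

def IsSubstochastic (P : L1 m →L[ℝ] L1 m) : Prop :=
  ∀ f : L1 m, 0 ≤ f → 0 ≤ P f ∧ ‖P f‖ ≤ ‖f‖

def IsStochastic (P : L1 m →L[ℝ] L1 m) : Prop :=
  ∀ f : L1 m, 0 ≤ f → 0 ≤ P f ∧ ‖P f‖ = ‖f‖

structure IsC0Semigroup (P : ℝ≥0 → L1 m →L[ℝ] L1 m) : Prop where
  map_zero : P 0 = ContinuousLinearMap.id ℝ (L1 m)
  map_add : ∀ s t : ℝ≥0, P (t + s) = (P t).comp (P s)
  continuous : ∀ f : L1 m, Continuous fun t => P t f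

def IsSubstochasticSemigroup (P : ℝ≥0 → L1 m →L[ℝ] L1 m) : Prop :=
  IsC0Semigroup P ∧ ∀ t, IsSubstochastic (P t)

def IsStochasticSemigroup (P : ℝ≥0 → L1 m →L[ℝ] L1 m) : Prop :=
  IsC0Semigroup P ∧ ∀ t, IsStochastic (P t)

/-- `G` is the infinitesimal generator of `P`: its domain consists exactly of those `f` for which
`lim_{t ↓ 0} (P(t) f - f) / t` exists, and `G f` is this limit. -/
def IsGenerator (P : ℝ≥0 → L1 m →L[ℝ] L1 m) (G : L1 m →ₗ.[ℝ] L1 m) : Prop :=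
  ∀ f g : L1 m, (f, g) ∈ G.graph ↔
    Tendsto (fun t : ℝ≥0 => (t : ℝ)⁻¹ • (P t f - f)) (𝓝[>] 0) (𝓝 g)

end Semigroups

/-! ### Perturbation of the generator and of the boundary condition

`A` is the maximal operator with domain `D = A.domain ⊆ L¹`, `B : D → L¹` is the inner
perturbation, and `Ψ₀, Ψ : D → L¹_∂` are the boundary operators. -/

section Perturbation

variable {E E' : Type*} [MeasurableSpace E] [MeasurableSpace E']
  {m : Measure E} {m' : Measure E'}

/-- Positivity of an operator defined on a subspace of `L¹`. -/
def IsPositiveOn {D : Submodule ℝ (L1 m)} (T : D →ₗ[ℝ] L1 m') : Prop :=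
  ∀ f : D, 0 ≤ (f : L1 m) → 0 ≤ T f

/-- `Φ : L¹_∂ → Ker(lam - A)` is a positive right inverse of `Ψ₀` restricted to `Ker(lam - A)`. -/
structure IsPositiveRightInverse (A : L1 m →ₗ.[ℝ] L1 m) (Ψ₀ : A.domain →ₗ[ℝ] L1 m') (lam : ℝ)
    (Φ : L1 m' →ₗ[ℝ] A.domain) : Prop where
  mem_ker : ∀ g : L1 m', lam • (Φ g : L1 m) - A (Φ g) = 0
  nonneg : ∀ g : L1 m', 0 ≤ g → 0 ≤ (Φ g : L1 m)
  right_inv : ∀ g : L1 m', Ψ₀ (Φ g) = g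

open Classical in
/-- The operator `Ψ(lam)`: the positive right inverse of `Ψ₀` restricted to `Ker(lam - A)`. Such an
inverse is unique as soon as `lam - A₀` is injective. By convention `Ψ(lam) = 0` if there is none,
which concerns only the case `Ψ₀ = 0`. -/
def dirichlet (A : L1 m →ₗ.[ℝ] L1 m) (Ψ₀ : A.domain →ₗ[ℝ] L1 m') (lam : ℝ) :
    L1 m' →ₗ[ℝ] A.domain :=
  if h : ∃ Φ, IsPositiveRightInverse A Ψ₀ lam Φ then h.choose else 0

variable (A : L1 m →ₗ.[ℝ] L1 m) (B : A.domain →ₗ[ℝ] L1 m) (Ψ₀ Ψ : A.domain →ₗ[ℝ] L1 m')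

/-- `A₀ = A` on `D(A₀) = {f ∈ D : Ψ₀ f = 0}`. -/
def opA0 : L1 m →ₗ.[ℝ] L1 m := restrictKer A Ψ₀

/-- `A_Ψ = A` on `D(A_Ψ) = {f ∈ D : Ψ₀ f = Ψ f}`. -/
def opAPsi : L1 m →ₗ.[ℝ] L1 m := restrictKer A (Ψ₀ - Ψ)

/-- `A_Ψ + B` on `D(A_Ψ)`. -/
def opAPsiB : L1 m →ₗ.[ℝ] L1 m := addOn (opAPsi A Ψ₀ Ψ) (B ∘ₗ inclKer A (Ψ₀ - Ψ))

/-- `R(lam, A₀)`, viewed as a map from `L¹` into `D`. -/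
def resA0 (lam : ℝ) : L1 m →ₗ[ℝ] A.domain := inclKer A Ψ₀ ∘ₗ resolvent (opA0 A Ψ₀) lam

/-- `R(lam, A_Ψ)`, viewed as a map from `L¹` into `D`. -/
def resAPsi (lam : ℝ) : L1 m →ₗ[ℝ] A.domain :=
  inclKer A (Ψ₀ - Ψ) ∘ₗ resolvent (opAPsi A Ψ₀ Ψ) lam

/-- `B R(lam, A_Ψ) : L¹ → L¹`. -/
def opBRPsi (lam : ℝ) : Module.End ℝ (L1 m) := B ∘ₗ resAPsi A Ψ₀ Ψ lam

/-- `Ψ Ψ(lam) : L¹_∂ → L¹_∂`. -/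
def opPsiPsi (lam : ℝ) : Module.End ℝ (L1 m') := Ψ ∘ₗ dirichlet A Ψ₀ lam

/-- The projection of `D × {0}` onto `D`. -/
def projD : (A.domain.prod (⊥ : Submodule ℝ (L1 m'))) →ₗ[ℝ] A.domain :=
  ((LinearMap.fst ℝ (L1 m) (L1 m')).comp
    (A.domain.prod (⊥ : Submodule ℝ (L1 m'))).subtype).codRestrict A.domain fun x => x.2.1

/-- The operator `𝒜(f, 0) = (A f, -Ψ₀ f)` in `L¹ × L¹_∂` with domain `D × {0}`. -/
def calA : (L1 m × L1 m') →ₗ.[ℝ] (L1 m × L1 m') where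
  domain := A.domain.prod ⊥
  toFun := (A.toFun.prod (-Ψ₀)) ∘ₗ projD A

/-- The operator `ℬ(f, 0) = (B f, Ψ f)` on `D(𝒜) = D × {0}`. -/
def calB : (calA A Ψ₀).domain →ₗ[ℝ] (L1 m × L1 m') := (B.prod Ψ) ∘ₗ projD A

/-- The operator `ℬ R(lam, 𝒜)` on `L¹ × L¹_∂`. If `Ψ₀` has right inverses in `Ker(lam - A)` and
`lam` is in the resolvent set of `A₀`, then `lam - 𝒜` is bijective. If `Ψ₀ = Ψ = 0`, then `lam - 𝒜`
is a bijection onto `L¹ × {0}` only, but `ℬ R(lam, 𝒜) (f, 0) = (B R(lam, A) f, 0)` stays there. -/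
def calBR (lam : ℝ) : Module.End ℝ (L1 m × L1 m') :=
  calB A B Ψ₀ Ψ ∘ₗ resolvent (calA A Ψ₀) lam

/-- The norm `‖f‖ + ‖f_∂‖` on `L¹ × L¹_∂`. -/
def sumNorm (z : L1 m × L1 m') : ℝ := ‖z.1‖ + ‖z.2‖

/-- `R(lam, A₀) B + Ψ(lam) Ψ : D → D`. -/
def stepOp (lam : ℝ) : Module.End ℝ A.domain :=
  resA0 A Ψ₀ lam ∘ₗ B + dirichlet A Ψ₀ lam ∘ₗ Ψ

/-- `P` is the perturbed semigroup: a substochastic semigroup whose generator `G` extends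
`(A_Ψ + B, D(A_Ψ))` and has for all `lam > 0` the resolvent
`R(lam, G) f = lim_{N → ∞} ∑_{n = 0}^{N} (R(lam, A₀) B + Ψ(lam) Ψ)ⁿ R(lam, A₀) f`.
(A `C₀`-semigroup is determined by the resolvent of its generator, so there is at most one.) -/
def IsPerturbedSemigroup (P : ℝ≥0 → L1 m →L[ℝ] L1 m) : Prop :=
  IsSubstochasticSemigroup P ∧
    ∃ G : L1 m →ₗ.[ℝ] L1 m, IsGenerator P G ∧ opAPsiB A B Ψ₀ Ψ ≤ G ∧
      ∀ lam : ℝ, 0 < lam → InResolventSet G lam ∧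
        ∀ f : L1 m,
          Tendsto (fun N : ℕ => ∑ n ∈ Finset.range (N + 1),
              (((stepOp A B Ψ₀ Ψ lam ^ n) (resA0 A Ψ₀ lam f) : A.domain) : L1 m))
            atTop (𝓝 (resolvent G lam f : L1 m))

end Perturbation

end KatoGreiner

end

open MeasureTheory Filter Topology
open scoped NNReal

noncomputable section

namespace KatoGreiner

/-! ### Contraction semigroups and their Laplace transforms -/

section ContractionSemigroup

variable {X : Type*} [NormedAddCommGroup X] [NormedSpace ℝ X]

/-! Put `T = R(lam, A₀) B + Ψ(lam) Ψ` on `D`. For `u ∈ D`, `v = T u` is the unique solution in `D`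
of `(lam - A) v = B u`, `Ψ₀ v = Ψ u`. On positive `u` norms are integrals, so the mass balance reads
`lam ‖u‖ + ‖B u‖ + ‖Ψ u‖ = ∫ (lam - A) u + ∫ Ψ₀ u`. Along `w, T w, T² w, ...` with `w = R(lam, A₀)
f`, `f ≥ 0`, the right side at one step is the loss `‖B ·‖ + ‖Ψ ·‖` of the step before. Telescoping
gives `lam ∑_{n ≤ N} ‖Tⁿ w‖ + ‖B T^N w‖ + ‖Ψ T^N w‖ = ‖f‖` (`sum_norm_katoTerm`), the identity on
which everything rests.

Existence: the series converges to a positive operator `R(lam)` with `lam ‖R(lam) f‖ ≤ ‖f‖`. These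
operators satisfy the resolvent identity (`katoL_resolvent_eq`), and `lam R(lam) → 1` because
`R(lam)` dominates `R(lam, A₀)` (`tendsto_smul_kato`). The Yosida approximation then produces a
positive contraction semigroup. Its generator extends `A_Ψ + B`, since for `Ψ₀ u = Ψ u` the series
at `(lam - A - B) u` telescopes to `u` (`kato_shift_sub`).

(a) By the Laplace transform, stochasticity means `lam ‖R(lam) f‖ = ‖f‖` for `f ≥ 0`, that is,
vanishing of the loss in the limit. That loss is the norm of `(ℬ R(lam, 𝒜))^{N+1} (f, 0)`
(`calBR_pow_succ`).

(b) Powers tending to zero make `1 - Ψ Ψ(lam)` and `1 - B R(lam, A_Ψ)` surjective, hence `lam - A_Ψ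
- B` is onto. The generator can then be no larger, and the mass balance on `D(A_Ψ)` is exact. -/

structure IsContractionSemigroup (P : ℝ≥0 → X →L[ℝ] X) : Prop where
  map_zero : P 0 = ContinuousLinearMap.id ℝ X
  map_add : ∀ s t : ℝ≥0, P (t + s) = (P t).comp (P s)
  continuous : ∀ f : X, Continuous fun t => P t f
  norm_le : ∀ t f, ‖P t f‖ ≤ ‖f‖

/-- `g` is the right derivative at `0` of the orbit of `f`. -/
def HasOrbitDeriv (P : ℝ≥0 → X →L[ℝ] X) (f g : X) : Prop :=
  Tendsto (fun t : ℝ≥0 => (t : ℝ)⁻¹ • (P t f - f)) (𝓝[>] 0) (𝓝 g)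

/-- `∫₀^∞ e^{-lam t} P(t) f dt`. -/
def laplace (P : ℝ≥0 → X →L[ℝ] X) (lam : ℝ) (f : X) : X :=
  ∫ t in Set.Ioi (0 : ℝ), Real.exp (-lam * t) • P t.toNNReal f

theorem tendsto_toReal_nhdsGT_zero :
    Tendsto (fun t : ℝ≥0 => (t : ℝ)) (𝓝[>] 0) (𝓝[>] 0) := by
  refine tendsto_nhdsWithin_iff.2 ⟨?_, ?_⟩
  · exact (NNReal.continuous_coe.tendsto' 0 0 rfl).mono_left nhdsWithin_le_nhds
  · filter_upwards [self_mem_nhdsWithin] with t ht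
    exact_mod_cast ht

theorem hasOrbitDeriv_of_hasDerivAt {P : ℝ≥0 → X →L[ℝ] X} {f g : X} {F : ℝ → X}
    (hF : HasDerivAt F g 0) (h0 : F 0 = f) (h : ∀ t : ℝ≥0, P t f = F t) :
    HasOrbitDeriv P f g := by
  have := (hasDerivWithinAt_iff_tendsto_slope' (s := Set.Ioi (0 : ℝ)) (by simp)).1
    hF.hasDerivWithinAt
  refine (this.comp tendsto_toReal_nhdsGT_zero).congr fun t => ?_
  simp [slope_def_module, h, h0]

namespace IsContractionSemigroup

variable {P : ℝ≥0 → X →L[ℝ] X} (hP : IsContractionSemigroup P) {lam : ℝ} (hlam : 0 < lam)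
include hP

theorem continuous_laplace_integrand (lam : ℝ) (f : X) :
    Continuous fun t : ℝ => Real.exp (-lam * t) • P t.toNNReal f := by
  exact Continuous.smul (by fun_prop) ((hP.continuous f).comp continuous_real_toNNReal)

theorem norm_laplace_integrand_le (lam : ℝ) (f : X) (t : ℝ) :
    ‖Real.exp (-lam * t) • P t.toNNReal f‖ ≤ Real.exp (-lam * t) * ‖f‖ := by
  rw [norm_smul, Real.norm_eq_abs, abs_of_pos (Real.exp_pos _)]
  exact mul_le_mul_of_nonneg_left (hP.norm_le _ _) (Real.exp_pos _).le

theorem commute (s t : ℝ≥0) (f : X) : P s (P t f) = P t (P s f) := by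
  have h1 := congrArg (fun T => T f) (hP.map_add t s)
  have h2 := congrArg (fun T => T f) (hP.map_add s t)
  simp only [ContinuousLinearMap.comp_apply] at h1 h2
  rw [← h1, ← h2, add_comm]

include hlam

theorem integrableOn_laplace (f : X) :
    IntegrableOn (fun t : ℝ => Real.exp (-lam * t) • P t.toNNReal f) (Set.Ioi 0) := by
  refine Integrable.mono' ((exp_neg_integrableOn_Ioi 0 hlam).mul_const ‖f‖)
    (hP.continuous_laplace_integrand lam f).aestronglyMeasurable ?_
  exact ae_of_all _ (hP.norm_laplace_integrand_le lam f)

theorem norm_laplace_le (f : X) : ‖laplace P lam f‖ ≤ lam⁻¹ * ‖f‖ := by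
  have h := norm_integral_le_of_norm_le ((exp_neg_integrableOn_Ioi 0 hlam).mul_const ‖f‖)
    (ae_of_all _ (hP.norm_laplace_integrand_le lam f))
  refine h.trans_eq ?_
  rw [integral_mul_const, integral_exp_mul_Ioi (by linarith)]
  simp

/-- The Laplace transform as a continuous linear map. -/
def laplaceL : X →L[ℝ] X :=
  LinearMap.mkContinuous
    { toFun := laplace P lam
      map_add' := fun f g => by
        simp only [laplace, _root_.map_add, smul_add]
        exact integral_add (hP.integrableOn_laplace hlam f) (hP.integrableOn_laplace hlam g)
      map_smul' := fun c f => by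
        simp only [laplace, map_smul, RingHom.id_apply, ← integral_smul]
        simp only [smul_comm c] } lam⁻¹ (hP.norm_laplace_le hlam)

@[simp] theorem laplaceL_apply (f : X) : hP.laplaceL hlam f = laplace P lam f := rfl

variable [CompleteSpace X]

theorem apply_laplace (s : ℝ≥0) (f : X) : P s (laplace P lam f) = laplace P lam (P s f) := by
  rw [laplace, ← (P s).integral_comp_comm (hP.integrableOn_laplace hlam f)]
  simp only [map_smul, laplace, hP.commute s]

/-- Translating the integration variable by `s` moves the dependence on `s` into a scalar factor and
an integration limit, so the orbit is differentiable at `0` for every `f`. -/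
theorem apply_laplace_eq (s : ℝ≥0) (f : X) : P s (laplace P lam f) =
    Real.exp (lam * s) • (laplace P lam f -
      ∫ t in (0 : ℝ)..s, Real.exp (-lam * t) • P t.toNNReal f) := by
  rw [laplace, ← (P s).integral_comp_comm (hP.integrableOn_laplace hlam f),
    ← intervalIntegral.integral_Ioi_sub_Ioi (hP.integrableOn_laplace hlam f)
      s.coe_nonneg, sub_sub_cancel,
    ← integral_smul]
  have hpre : (fun t : ℝ => t + s) ⁻¹' Set.Ioi (s : ℝ) = Set.Ioi 0 := by
    ext t; simp
  have := (measurePreserving_add_right (volume : Measure ℝ) (s : ℝ)).setIntegral_preimage_emb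
    (measurableEmbedding_addRight (s : ℝ))
    (fun t : ℝ => Real.exp (lam * s) • (Real.exp (-lam * t) • P t.toNNReal f)) (Set.Ioi (s : ℝ))
  rw [hpre] at this
  refine Eq.trans ?_ this
  refine setIntegral_congr_fun measurableSet_Ioi fun t ht => ?_
  have ht' : (t + s).toNNReal = s + t.toNNReal := by
    rw [Real.toNNReal_add (le_of_lt ht) s.coe_nonneg, add_comm]; simp
  simp only [ht', hP.map_add, map_smul, ContinuousLinearMap.comp_apply, smul_smul, ← Real.exp_add]
  congr 2; ring

theorem hasOrbitDeriv_laplace (f : X) :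
    HasOrbitDeriv P (laplace P lam f) (lam • laplace P lam f - f) := by
  have h1 : HasDerivAt (fun s : ℝ => ∫ t in (0 : ℝ)..s, Real.exp (-lam * t) • P t.toNNReal f)
      f 0 := by
    have hc := hP.continuous_laplace_integrand lam f
    simpa [hP.map_zero] using intervalIntegral.integral_hasDerivAt_right
      (a := (0 : ℝ)) (b := 0) (hc.intervalIntegrable 0 0)
      (hc.stronglyMeasurableAtFilter volume _) hc.continuousAt
  have h2 : HasDerivAt (fun s : ℝ => Real.exp (lam * s)) lam 0 := by
    simpa using ((hasDerivAt_id (0 : ℝ)).const_mul lam).exp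
  have h3 := h2.smul (h1.const_sub (laplace P lam f))
  refine hasOrbitDeriv_of_hasDerivAt (h3.congr_deriv ?_) ?_
    (hP.apply_laplace_eq hlam · f)
  · simp; abel
  · simp

/-- The transform is continuous and commutes with `P`, so the derivative of the orbit of `laplace P
lam f` is both `laplace P lam g` and `lam • laplace P lam f - f`. -/
theorem laplace_of_hasOrbitDeriv {f g : X} (h : HasOrbitDeriv P f g) :
    laplace P lam (lam • f - g) = f := by
  have h1 := hP.hasOrbitDeriv_laplace hlam f
  have h2 := ((hP.laplaceL hlam).continuous.tendsto g).comp h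
  have h3 : laplace P lam g = lam • laplace P lam f - f := by
    refine tendsto_nhds_unique h2 (h1.congr fun t => ?_)
    simp only [Function.comp, map_smul, map_sub, laplaceL_apply, hP.apply_laplace hlam]
  rw [← hP.laplaceL_apply hlam, map_sub, map_smul, laplaceL_apply, laplaceL_apply, h3,
    sub_sub_cancel]

omit hlam

theorem tendsto_smul_laplace (f : X) :
    Tendsto (fun lam : ℝ => lam • laplace P lam f) atTop (𝓝 f) := by
  have h0 : (∫ t in Set.Ioi (0 : ℝ), Real.exp (-t) • f) = f := by
    rw [integral_smul_const, integral_exp_neg_Ioi_zero, one_smul]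
  -- The substitution `t ↦ lam⁻¹ * t` frees the exponential weight of `lam`, so that dominated
  -- convergence applies.
  have h1 : Tendsto (fun lam : ℝ => ∫ t in Set.Ioi (0 : ℝ),
      Real.exp (-t) • P (lam⁻¹ * t).toNNReal f) atTop (𝓝 f) := by
    conv => enter [3]; rw [← h0]
    refine tendsto_integral_filter_of_dominated_convergence (fun t => Real.exp (-t) * ‖f‖)
      ?_ ?_ ((integrableOn_exp_neg_Ioi 0).mul_const _) ?_
    · refine Eventually.of_forall fun lam => Continuous.aestronglyMeasurable ?_
      exact Continuous.smul (by fun_prop) ((hP.continuous f).comp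
        (continuous_real_toNNReal.comp (continuous_const.mul continuous_id)))
    · refine Eventually.of_forall fun lam => ae_of_all _ fun t => ?_
      rw [norm_smul, Real.norm_eq_abs, abs_of_pos (Real.exp_pos _)]
      exact mul_le_mul_of_nonneg_left (hP.norm_le _ _) (Real.exp_pos _).le
    · refine ae_of_all _ fun t => ?_
      have h2 : Tendsto (fun lam : ℝ => (lam⁻¹ * t).toNNReal) atTop (𝓝 0) := by
        have := (tendsto_inv_atTop_zero (𝕜 := ℝ)).mul_const t
        rw [zero_mul] at this
        simpa [Function.comp_def] using (continuous_real_toNNReal.tendsto _).comp this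
      have h3 := (((hP.continuous f).tendsto 0).comp h2).const_smul (Real.exp (-t))
      simpa [hP.map_zero] using h3
  refine h1.congr' ?_
  filter_upwards [eventually_gt_atTop 0] with lam hlam
  have := integral_comp_mul_left_Ioi
    (fun t => Real.exp (-t) • P (lam⁻¹ * t).toNNReal f) 0 hlam
  rw [mul_zero] at this
  rw [← inv_smul_eq_iff₀ hlam.ne', ← this, laplace]
  refine setIntegral_congr_fun measurableSet_Ioi fun t _ => ?_
  simp only [inv_mul_cancel_left₀ hlam.ne', neg_mul]

omit hP [CompleteSpace X] in
theorem laplace_nonneg [PartialOrder X] [IsOrderedAddMonoid X] [IsOrderedModule ℝ X]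
    [ClosedIciTopology X] (hpos : ∀ t f, 0 ≤ f → 0 ≤ P t f) {f : X} (hf : 0 ≤ f) :
    0 ≤ laplace P lam f :=
  integral_nonneg fun _ => smul_nonneg (Real.exp_pos _).le (hpos _ _ hf)

end IsContractionSemigroup

end ContractionSemigroup

/-! ### Exponentials of bounded operators -/

section Exponential

variable {X : Type*} [NormedAddCommGroup X] [NormedSpace ℝ X] [CompleteSpace X]

theorem exp_add_of_commute {a b : X →L[ℝ] X} (h : Commute a b) :
    NormedSpace.exp (a + b) = NormedSpace.exp a * NormedSpace.exp b :=
  letI := NormedAlgebra.restrictScalars ℚ ℝ (X →L[ℝ] X)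
  NormedSpace.exp_add_of_commute h

theorem hasSum_exp_apply (a : X →L[ℝ] X) (x : X) :
    HasSum (fun n : ℕ => ((n.factorial : ℝ)⁻¹) • (a ^ n) x) (NormedSpace.exp a x) :=
  (NormedSpace.exp_series_hasSum_exp' (𝕂 := ℝ) a).mapL (ContinuousLinearMap.apply ℝ X x)

omit [CompleteSpace X] in
theorem exp_smul_one (c : ℝ) :
    NormedSpace.exp (c • (1 : X →L[ℝ] X)) = Real.exp c • (1 : X →L[ℝ] X) := by
  rw [← Algebra.algebraMap_eq_smul_one, ← NormedSpace.algebraMap_exp_comm, ← Real.exp_eq_exp_ℝ,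
    Algebra.algebraMap_eq_smul_one]

theorem norm_exp_apply_le {a : X →L[ℝ] X} {c : ℝ} (h : ∀ x, ‖a x‖ ≤ c * ‖x‖) (hc : 0 ≤ c)
    (x : X) : ‖NormedSpace.exp a x‖ ≤ Real.exp c * ‖x‖ := by
  have h1 : ∀ n : ℕ, ‖(a ^ n) x‖ ≤ c ^ n * ‖x‖ := by
    intro n
    induction n with
    | zero => simp
    | succ n ih =>
      rw [pow_succ', mul_apply_eq_comp, pow_succ', mul_assoc]
      exact (h _).trans (mul_le_mul_of_nonneg_left ih hc)
  have h2 : HasSum (fun n : ℕ => ((n.factorial : ℝ)⁻¹) • c ^ n * ‖x‖) (Real.exp c * ‖x‖) := by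
    have := (NormedSpace.exp_series_hasSum_exp' (𝕂 := ℝ) c).mul_right ‖x‖
    rwa [← Real.exp_eq_exp_ℝ] at this
  rw [← (hasSum_exp_apply a x).tsum_eq]
  refine tsum_of_norm_bounded h2 fun n => ?_
  rw [norm_smul, norm_inv, Real.norm_natCast, smul_eq_mul, mul_assoc]
  exact mul_le_mul_of_nonneg_left (h1 n) (by positivity)

theorem hasDerivAt_exp_smul_apply (a : X →L[ℝ] X) (x : X) (s : ℝ) :
    HasDerivAt (fun u : ℝ => NormedSpace.exp (u • a) x) (NormedSpace.exp (s • a) (a x)) s :=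
  (ContinuousLinearMap.apply ℝ X x).hasFDerivAt.comp_hasDerivAt s (hasDerivAt_exp_smul_const a s)

theorem continuous_exp_smul_apply (a : X →L[ℝ] X) (x : X) :
    Continuous fun u : ℝ => NormedSpace.exp (u • a) x :=
  continuous_iff_continuousAt.2 fun s => (hasDerivAt_exp_smul_apply a x s).continuousAt

/-- The curve `s ↦ exp(s(a - b)) exp(b) x` joins `exp(b) x` to `exp(a) x`. By commutation its
derivative is `exp(sa) exp((1-s)b) (a - b) x`, and the two exponentials are contractions. -/
theorem norm_exp_sub_exp_le {a b : X →L[ℝ] X} (hab : Commute a b)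
    (ha : ∀ s : ℝ, 0 ≤ s → ∀ x, ‖NormedSpace.exp (s • a) x‖ ≤ ‖x‖)
    (hb : ∀ s : ℝ, 0 ≤ s → ∀ x, ‖NormedSpace.exp (s • b) x‖ ≤ ‖x‖) (x : X) :
    ‖NormedSpace.exp a x - NormedSpace.exp b x‖ ≤ ‖a x - b x‖ := by
  have hb' : Commute (a - b) b := hab.sub_left (Commute.refl b)
  have h := norm_image_sub_le_of_norm_deriv_le_segment_01'
    (C := ‖a x - b x‖) 
    (fun s _ => (hasDerivAt_exp_smul_apply (a - b) (NormedSpace.exp b x) s).hasDerivWithinAt)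
    fun s hs => ?_
  · simp only [one_smul, zero_smul, NormedSpace.exp_zero, one_apply_eq_self] at h
    rwa [← mul_apply_eq_comp, ← exp_add_of_commute hb', sub_add_cancel] at h
  · have h1 : NormedSpace.exp (s • (a - b)) * (a - b) * NormedSpace.exp b =
        NormedSpace.exp (s • a) * NormedSpace.exp ((1 - s) • b) * (a - b) := by
      have h2 : Commute (a - b) (NormedSpace.exp b) := hb'.exp_right
      rw [mul_assoc, h2.eq, ← mul_assoc, ← exp_add_of_commute (hb'.smul_left s),
        ← exp_add_of_commute ((hab.smul_left s).smul_right (1 - s))]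
      congr 2
      module
    have h3 := congrArg (fun T : X →L[ℝ] X => T x) h1
    simp only [mul_apply_eq_comp] at h3
    rw [h3]
    exact (ha s hs.1 _).trans (hb _ (by linarith [hs.2]) _)

theorem exp_apply_nonneg [PartialOrder X] [IsOrderedAddMonoid X] [IsOrderedModule ℝ X]
    [OrderClosedTopology X] {a : X →L[ℝ] X} (ha : ∀ x, 0 ≤ x → 0 ≤ a x) {x : X} (hx : 0 ≤ x) :
    0 ≤ NormedSpace.exp a x := by
  have h1 : ∀ n : ℕ, 0 ≤ (a ^ n) x := by
    intro n
    induction n with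
    | zero => simpa
    | succ n ih =>
      rw [pow_succ', mul_apply_eq_comp]
      exact ha _ ih
  rw [← (hasSum_exp_apply a x).tsum_eq]
  exact tsum_nonneg fun n => smul_nonneg (by positivity) (h1 n)

theorem exists_tendsto_of_dense {T : ℕ → X →L[ℝ] X} (hT : ∀ n x, ‖T n x‖ ≤ ‖x‖) {s : Set X}
    (hs : Dense s) (h : ∀ x ∈ s, CauchySeq fun n => T n x) :
    ∃ S : X →L[ℝ] X, (∀ x, Tendsto (fun n => T n x) atTop (𝓝 (S x))) ∧ ∀ x, ‖S x‖ ≤ ‖x‖ := by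
  have hc : ∀ x, CauchySeq fun n => T n x := by
    intro x
    refine Metric.cauchySeq_iff'.2 fun ε hε => ?_
    obtain ⟨y, hy, hxy⟩ := hs.exists_dist_lt x (show 0 < ε / 4 by positivity)
    obtain ⟨N, hN⟩ := Metric.cauchySeq_iff'.1 (h y hy) (ε / 4) (by positivity)
    refine ⟨N, fun n hn => ?_⟩
    have h1 := hT n (x - y)
    have h2 := hT N (x - y)
    have h3 := hN n hn
    rw [map_sub] at h1 h2
    rw [dist_eq_norm] at hxy h3 ⊢
    have : T n x - T N x = (T n x - T n y) + (T n y - T N y) - (T N x - T N y) := by abel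
    rw [this]
    have h4 := norm_sub_le ((T n x - T n y) + (T n y - T N y)) (T N x - T N y)
    have h5 := norm_add_le (T n x - T n y) (T n y - T N y)
    linarith
  choose S hS using fun x => cauchySeq_tendsto_of_complete (hc x)
  have hle : ∀ x, ‖S x‖ ≤ ‖x‖ := fun x =>
    le_of_tendsto (hS x).norm (Eventually.of_forall fun n => hT n x)
  exact ⟨LinearMap.mkContinuous
    { toFun := S
      map_add' := fun x y => tendsto_nhds_unique (hS _) (by simpa using (hS x).add (hS y))
      map_smul' := fun c x => tendsto_nhds_unique (hS _) (by simpa using (hS x).const_smul c) } 1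
    (by simpa using hle), hS, hle⟩

end Exponential

/-! ### The generation theorem -/

section Generation

variable {X : Type*} [NormedAddCommGroup X] [NormedSpace ℝ X]

/-- A pseudo-resolvent `lam ↦ R(lam)` on `(0, ∞)` with `‖lam R(lam)‖ ≤ 1` and
`lam R(lam) → 1` strongly as `lam → ∞`. -/
structure IsContractionResolvent (R : ℝ → X →L[ℝ] X) : Prop where
  resolvent_eq : ∀ ⦃lam mu : ℝ⦄, 0 < lam → 0 < mu → ∀ f,
    R lam f = R mu f + (mu - lam) • R mu (R lam f)
  norm_le : ∀ ⦃lam : ℝ⦄, 0 < lam → ∀ f, ‖R lam f‖ ≤ lam⁻¹ * ‖f‖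
  tendsto : ∀ f, Tendsto (fun lam : ℝ => lam • R lam f) atTop (𝓝 f)

/-- The Yosida approximation `mu² R(mu) - mu`. -/
def yosida (R : ℝ → X →L[ℝ] X) (mu : ℝ) : X →L[ℝ] X := mu ^ 2 • R mu - mu • 1

namespace IsContractionResolvent

variable {R : ℝ → X →L[ℝ] X} (hR : IsContractionResolvent R)
include hR

theorem commute {lam mu : ℝ} (hlam : 0 < lam) (hmu : 0 < mu) : Commute (R lam) (R mu) := by
  rcases eq_or_ne lam mu with rfl | hne
  · exact Commute.refl _
  ext f
  have h1 := hR.resolvent_eq hlam hmu f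
  have h2 := hR.resolvent_eq hmu hlam f
  have h3 : (mu - lam) • (R mu (R lam f) - R lam (R mu f)) = 0 := by
    have : (lam - mu) • R lam (R mu f) = -((mu - lam) • R lam (R mu f)) := by
      rw [← neg_smul, neg_sub]
    rw [this] at h2
    rw [smul_sub, sub_eq_zero]
    have h4 := eq_sub_of_add_eq' h1.symm
    have h5 : (mu - lam) • R lam (R mu f) = R lam f - R mu f :=
      eq_sub_of_add_eq' (add_eq_of_eq_add_neg h2)
    rw [h4, h5]
  have h4 := (smul_eq_zero.1 h3).resolve_left (sub_ne_zero.2 hne.symm)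
  exact (sub_eq_zero.1 h4).symm

theorem commute_yosida {lam mu : ℝ} (hlam : 0 < lam) (hmu : 0 < mu) :
    Commute (yosida R lam) (yosida R mu) := by
  refine Commute.sub_left (Commute.sub_right ?_ ?_) (Commute.sub_right ?_ ?_)
  · exact ((hR.commute hlam hmu).smul_left _).smul_right _
  · exact (Commute.one_right _).smul_right _
  · exact (Commute.one_left _).smul_left _
  · exact (Commute.one_right _).smul_right _

/-- The generator sends `R 1 f` to `R 1 f - f`; on this range the Yosida approximation is `mu R(mu)`
applied to that value, hence bounded uniformly in `mu` and convergent. -/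
theorem yosida_apply {mu : ℝ} (hmu : 0 < mu) (f : X) :
    yosida R mu (R 1 f) = mu • R mu (R 1 f - f) := by
  have h := hR.resolvent_eq one_pos hmu f
  have h' : (mu - 1) • R mu (R 1 f) = R 1 f - R mu f := by rw [eq_sub_iff_add_eq', ← h]
  have h2 : mu • R mu (R 1 f) = R 1 f - R mu f + R mu (R 1 f) := by
    rw [← h', sub_smul, one_smul, sub_add_cancel]
  simp only [yosida, sub_apply, smul_apply,
    one_apply_eq_self, pow_two, mul_smul, ← smul_sub, map_sub]
  rw [h2]
  congr 1
  abel

theorem dense_range : Dense (Set.range (R 1)) := by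
  intro f
  refine mem_closure_of_tendsto (hR.tendsto f) ?_
  filter_upwards [eventually_gt_atTop 0] with lam hlam
  refine ⟨lam • (f + (1 - lam) • R lam f), ?_⟩
  rw [map_smul, _root_.map_add, map_smul, ← hR.resolvent_eq hlam one_pos]

variable [CompleteSpace X]

omit hR in
-- Splitting off the scalar part leaves the exponential of a multiple of `R mu`, nonnegative for `t
-- ≥ 0`; contractivity and positivity are both read off this form.
theorem exp_yosida (R : ℝ → X →L[ℝ] X) (mu t : ℝ) : NormedSpace.exp (t • yosida R mu) =
    Real.exp (-(t * mu)) • NormedSpace.exp ((t * mu ^ 2) • R mu) := by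
  have : t • yosida R mu = (-(t * mu)) • (1 : X →L[ℝ] X) + (t * mu ^ 2) • R mu := by
    rw [yosida]; module
  rw [this, exp_add_of_commute ((Commute.one_left _).smul_left _), exp_smul_one, smul_mul_assoc,
    one_mul]

theorem norm_exp_yosida_le {mu : ℝ} (hmu : 0 < mu) {t : ℝ} (ht : 0 ≤ t) (f : X) :
    ‖NormedSpace.exp (t • yosida R mu) f‖ ≤ ‖f‖ := by
  have h1 : ∀ f, ‖((t * mu ^ 2) • R mu) f‖ ≤ (t * mu) * ‖f‖ := by
    intro f
    rw [smul_apply, norm_smul, Real.norm_of_nonneg (by positivity)]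
    refine (mul_le_mul_of_nonneg_left (hR.norm_le hmu f) (by positivity)).trans_eq ?_
    field_simp
  rw [exp_yosida, smul_apply, norm_smul,
    Real.norm_of_nonneg (Real.exp_pos _).le]
  refine (mul_le_mul_of_nonneg_left (norm_exp_apply_le h1 (by positivity) f)
    (Real.exp_pos _).le).trans_eq ?_
  rw [← mul_assoc, ← Real.exp_add, neg_add_cancel, Real.exp_zero, one_mul]

omit hR in
theorem exp_yosida_nonneg [PartialOrder X] [IsOrderedAddMonoid X] [IsOrderedModule ℝ X]
    [OrderClosedTopology X] {mu : ℝ} (hpos : ∀ f, 0 ≤ f → 0 ≤ R mu f) {t : ℝ} (ht : 0 ≤ t)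
    {f : X} (hf : 0 ≤ f) : 0 ≤ NormedSpace.exp (t • yosida R mu) f := by
  rw [exp_yosida, smul_apply]
  exact smul_nonneg (Real.exp_pos _).le
    (exp_apply_nonneg (fun g hg => smul_nonneg (by positivity) (hpos g hg)) hf)

theorem norm_exp_yosida_sub_le {lam mu : ℝ} (hlam : 0 < lam) (hmu : 0 < mu) {s t : ℝ}
    (hs : 0 ≤ s) (ht : 0 ≤ t) (f : X) :
    ‖NormedSpace.exp (s • yosida R lam) f - NormedSpace.exp (t • yosida R mu) f‖ ≤
      ‖s • yosida R lam f - t • yosida R mu f‖ := by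
  refine norm_exp_sub_exp_le (((hR.commute_yosida hlam hmu).smul_left s).smul_right t) ?_ ?_ f
  · intro r hr x
    rw [smul_smul]
    exact hR.norm_exp_yosida_le hlam (by positivity) x
  · intro r hr x
    rw [smul_smul]
    exact hR.norm_exp_yosida_le hmu (by positivity) x

omit [CompleteSpace X] in
theorem tendsto_yosida (f : X) :
    Tendsto (fun n : ℕ => yosida R (n + 1 : ℝ) (R 1 f)) atTop (𝓝 (R 1 f - f)) := by
  have h : Tendsto (fun n : ℕ => (n + 1 : ℝ)) atTop atTop :=
    tendsto_atTop_add_const_right _ _ tendsto_natCast_atTop_atTop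
  refine ((hR.tendsto (R 1 f - f)).comp h).congr fun n => ?_
  rw [hR.yosida_apply (by positivity)]
  rfl

theorem exists_limit {t : ℝ} (ht : 0 ≤ t) :
    ∃ S : X →L[ℝ] X, (∀ f, Tendsto (fun n : ℕ =>
      NormedSpace.exp (t • yosida R (n + 1 : ℝ)) f) atTop (𝓝 (S f))) ∧ ∀ f, ‖S f‖ ≤ ‖f‖ := by
  refine exists_tendsto_of_dense (fun n f => hR.norm_exp_yosida_le (by positivity) ht f)
    hR.dense_range ?_
  rintro _ ⟨f, rfl⟩
  refine Metric.cauchySeq_iff'.2 fun ε hε => ?_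
  obtain ⟨N, hN⟩ := Metric.cauchySeq_iff'.1 ((hR.tendsto_yosida f).const_smul t).cauchySeq ε hε
  refine ⟨N, fun n hn => lt_of_le_of_lt ?_ (hN n hn)⟩
  rw [dist_eq_norm, dist_eq_norm]
  exact hR.norm_exp_yosida_sub_le (by positivity) (by positivity) ht ht _

/-- The semigroup generated by `lam - R(lam)⁻¹`: the strong limit of the exponentials of the Yosida
approximations. -/
def semigroup (t : ℝ≥0) : X →L[ℝ] X := (hR.exists_limit t.coe_nonneg).choose

theorem tendsto_semigroup (t : ℝ≥0) (f : X) :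
    Tendsto (fun n : ℕ => NormedSpace.exp ((t : ℝ) • yosida R (n + 1 : ℝ)) f) atTop
      (𝓝 (hR.semigroup t f)) :=
  (hR.exists_limit t.coe_nonneg).choose_spec.1 f

theorem norm_semigroup_le (t : ℝ≥0) (f : X) : ‖hR.semigroup t f‖ ≤ ‖f‖ :=
  (hR.exists_limit t.coe_nonneg).choose_spec.2 f

theorem tendsto_semigroup_of_tendsto (t : ℝ≥0) {g : ℕ → X} {f : X}
    (hg : Tendsto g atTop (𝓝 f)) :
    Tendsto (fun n : ℕ => NormedSpace.exp ((t : ℝ) • yosida R (n + 1 : ℝ)) (g n)) atTop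
      (𝓝 (hR.semigroup t f)) := by
  have h1 : Tendsto (fun n : ℕ => NormedSpace.exp ((t : ℝ) • yosida R (n + 1 : ℝ)) (g n - f))
      atTop (𝓝 0) := by
    refine squeeze_zero_norm (fun n => hR.norm_exp_yosida_le (by positivity) t.coe_nonneg _) ?_
    simpa using (hg.sub_const f).norm
  simpa using h1.add (hR.tendsto_semigroup t f)

theorem semigroup_nonneg [PartialOrder X] [IsOrderedAddMonoid X] [IsOrderedModule ℝ X]
    [OrderClosedTopology X] (hpos : ∀ lam, 0 < lam → ∀ f, 0 ≤ f → 0 ≤ R lam f) (t : ℝ≥0) {f : X}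
    (hf : 0 ≤ f) : 0 ≤ hR.semigroup t f :=
  ge_of_tendsto' (hR.tendsto_semigroup t f) fun n =>
    exp_yosida_nonneg (hpos _ (by positivity)) t.coe_nonneg hf

theorem continuous_semigroup (f : X) : Continuous fun t => hR.semigroup t f := by
  have h1 : ∀ f, Continuous fun t => hR.semigroup t (R 1 f) := by
    intro f
    refine (LipschitzWith.of_dist_le_mul (K := ‖R 1 f - f‖₊) fun s t => ?_).continuous
    rw [dist_eq_norm, NNReal.dist_eq, mul_comm, coe_nnnorm]
    refine le_of_tendsto_of_tendsto' ((hR.tendsto_semigroup s _).sub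
      (hR.tendsto_semigroup t _)).norm ((hR.tendsto_yosida f).norm.const_mul |(s : ℝ) - t|)
      fun n => ?_
    refine (hR.norm_exp_yosida_sub_le (by positivity) (by positivity) s.coe_nonneg t.coe_nonneg
      _).trans_eq ?_
    rw [← sub_smul, norm_smul, Real.norm_eq_abs]
  refine continuous_of_uniform_approx_of_continuous fun u hu => ?_
  obtain ⟨ε, hε, hu⟩ := Metric.mem_uniformity_dist.1 hu
  obtain ⟨_, ⟨y, rfl⟩, hy⟩ := hR.dense_range.exists_dist_lt f hε
  refine ⟨_, h1 y, fun t => hu ?_⟩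
  rw [dist_eq_norm, ← map_sub]
  exact (hR.norm_semigroup_le _ _).trans_lt (by rwa [← dist_eq_norm])

theorem isContractionSemigroup : IsContractionSemigroup hR.semigroup where
  map_zero := by
    ext f
    exact tendsto_nhds_unique (hR.tendsto_semigroup 0 f) (by simp)
  map_add s t := by
    ext f
    refine tendsto_nhds_unique (hR.tendsto_semigroup (t + s) f)
      ((hR.tendsto_semigroup_of_tendsto t (hR.tendsto_semigroup s f)).congr fun n => ?_)
    rw [NNReal.coe_add, add_smul, exp_add_of_commute
      (((Commute.refl _).smul_left _).smul_right _), mul_apply_eq_comp]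
  continuous := hR.continuous_semigroup
  norm_le := hR.norm_semigroup_le

/-- The approximating exponentials satisfy this integral equation by the fundamental theorem of
calculus; their integrands are dominated by `‖R 1 f - f‖`. -/
theorem semigroup_sub (t : ℝ≥0) (f : X) : hR.semigroup t (R 1 f) - R 1 f =
    ∫ s in (0 : ℝ)..t, hR.semigroup s.toNNReal (R 1 f - f) := by
  have h1 : ∀ n : ℕ, NormedSpace.exp ((t : ℝ) • yosida R (n + 1 : ℝ)) (R 1 f) - R 1 f =
      ∫ s in (0 : ℝ)..t, NormedSpace.exp (s • yosida R (n + 1 : ℝ))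
        (yosida R (n + 1 : ℝ) (R 1 f)) := by
    intro n
    rw [intervalIntegral.integral_eq_sub_of_hasDerivAt (fun s _ => hasDerivAt_exp_smul_apply _ _ s)
      ((continuous_exp_smul_apply _ _).intervalIntegrable _ _)]
    simp
  refine tendsto_nhds_unique ((hR.tendsto_semigroup t (R 1 f)).sub_const _) ?_
  simp only [h1]
  refine intervalIntegral.tendsto_integral_filter_of_dominated_convergence
    (fun _ => ‖R 1 f - f‖) ?_ ?_ (by simp) ?_
  · exact Eventually.of_forall fun n => (continuous_exp_smul_apply _ _).aestronglyMeasurable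
  · refine Eventually.of_forall fun n => ae_of_all _ fun s hs => ?_
    rw [Set.uIoc_of_le t.coe_nonneg] at hs
    refine (hR.norm_exp_yosida_le (by positivity) hs.1.le _).trans ?_
    rw [hR.yosida_apply (by positivity), norm_smul, Real.norm_of_nonneg (by positivity)]
    refine (mul_le_mul_of_nonneg_left (hR.norm_le (by positivity) _) (by positivity)).trans_eq ?_
    field_simp
  · refine ae_of_all _ fun s hs => ?_
    rw [Set.uIoc_of_le t.coe_nonneg] at hs
    have := hR.tendsto_semigroup_of_tendsto s.toNNReal (hR.tendsto_yosida f)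
    rwa [Real.coe_toNNReal _ hs.1.le] at this

theorem hasOrbitDeriv_semigroup (f : X) : HasOrbitDeriv hR.semigroup (R 1 f) (R 1 f - f) := by
  have hc : Continuous fun s : ℝ => hR.semigroup s.toNNReal (R 1 f - f) :=
    (hR.continuous_semigroup _).comp continuous_real_toNNReal
  have h1 : HasDerivAt (fun s : ℝ => ∫ t in (0 : ℝ)..s, hR.semigroup t.toNNReal (R 1 f - f))
      (R 1 f - f) 0 := by
    have := intervalIntegral.integral_hasDerivAt_right
      (a := (0 : ℝ)) (b := 0) (hc.intervalIntegrable 0 0)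
      (hc.stronglyMeasurableAtFilter volume _) hc.continuousAt
    simpa [hR.isContractionSemigroup.map_zero] using this
  refine hasOrbitDeriv_of_hasDerivAt (h1.const_add (R 1 f)) (by simp) fun t => ?_
  rw [← hR.semigroup_sub, add_sub_cancel]

theorem hasOrbitDeriv_semigroup_iff {f g : X} :
    HasOrbitDeriv hR.semigroup f g ↔ R 1 (f - g) = f := by
  have hS := hR.isContractionSemigroup
  have key : ∀ h, laplace hR.semigroup 1 h = R 1 h := fun h => by
    simpa using hS.laplace_of_hasOrbitDeriv one_pos (hR.hasOrbitDeriv_semigroup h)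
  constructor
  · intro h
    simpa [key] using hS.laplace_of_hasOrbitDeriv one_pos h
  · intro h
    simpa [h] using hR.hasOrbitDeriv_semigroup (f - g)

end IsContractionResolvent

end Generation

/-! ### Generators of contraction semigroups -/

section Generator

variable {X : Type*} [NormedAddCommGroup X] [NormedSpace ℝ X]

theorem exists_generator (P : ℝ≥0 → X →L[ℝ] X) :
    ∃ G : X →ₗ.[ℝ] X, ∀ f g : X, (f, g) ∈ G.graph ↔ HasOrbitDeriv P f g := by
  let S : Submodule ℝ (X × X) :=
    { carrier := {z | HasOrbitDeriv P z.1 z.2}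
      zero_mem' := by simp [HasOrbitDeriv]
      add_mem' := fun {a b} ha hb => (ha.add hb).congr fun t => by
        simp only [Prod.fst_add, _root_.map_add]; module
      smul_mem' := fun c a ha => (ha.const_smul c).congr fun t => by
        simp only [Prod.smul_fst, map_smul]; module }
  refine ⟨S.toLinearPMap, fun f g => ?_⟩
  rw [Submodule.toLinearPMap_graph_eq S]
  · rfl
  · rintro ⟨x, y⟩ (hxy : HasOrbitDeriv P x y) (rfl : x = 0)
    exact tendsto_nhds_unique hxy (by simp)

variable [CompleteSpace X] {P : ℝ≥0 → X →L[ℝ] X} (hP : IsContractionSemigroup P)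
  {G : X →ₗ.[ℝ] X} (hG : ∀ f g : X, (f, g) ∈ G.graph ↔ HasOrbitDeriv P f g)
  {lam : ℝ} (hlam : 0 < lam)

theorem shift_apply {Y : Type*} [AddCommGroup Y] [Module ℝ Y] (T : Y →ₗ.[ℝ] Y) (lam : ℝ)
    (x : T.domain) : shift T lam x = lam • (x : Y) - T x := rfl

include hP hG hlam

theorem laplace_shift (x : G.domain) : laplace P lam (shift G lam x) = x :=
  hP.laplace_of_hasOrbitDeriv hlam ((hG _ _).1 (G.mem_graph x))

theorem bijective_shift : Function.Bijective (shift G lam) := by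
  constructor
  · intro x y hxy
    apply Subtype.ext
    rw [← laplace_shift hP hG hlam x, hxy, laplace_shift hP hG hlam y]
  · intro f
    have h := (hG _ _).2 (hP.hasOrbitDeriv_laplace hlam f)
    obtain ⟨x, hx, hx'⟩ := G.mem_graph_iff.1 h
    exact ⟨x, by rw [shift_apply, hx', hx]; simp⟩

theorem resolvent_eq_laplace (f : X) : (resolvent G lam f : X) = laplace P lam f := by
  rw [← laplace_shift hP hG hlam, shift_resolvent _ _ (bijective_shift hP hG hlam)]

theorem inResolventSet : InResolventSet G lam :=
  ⟨bijective_shift hP hG hlam, lam⁻¹, fun f => by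
    rw [resolvent_eq_laplace hP hG hlam]; exact hP.norm_laplace_le hlam f⟩

end Generator

/-! ### The positive cone of `L¹` -/

section Cone

variable {E : Type*} [MeasurableSpace E] {m : Measure E}

instance : IsOrderedModule ℝ (L1 m) :=
  have h : ∀ c : ℝ, 0 ≤ c → ∀ f : L1 m, 0 ≤ f → 0 ≤ c • f := by
    intro c hc f hf
    rw [← Lp.coeFn_nonneg] at hf ⊢
    filter_upwards [hf, Lp.coeFn_smul c f] with x hx hx'
    rw [hx']
    exact mul_nonneg hc hx
  IsOrderedModule.of_smul_nonneg h

/-- The integral as a continuous linear functional on `L¹`. -/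
def mass : L1 m →L[ℝ] ℝ := L1.integralCLM

theorem mass_eq_integral (f : L1 m) : mass f = ∫ x, f x ∂m := by
  rw [← L1.integral_eq_integral, L1.integral_eq]; rfl

theorem mass_eq_norm {f : L1 m} (hf : 0 ≤ f) : mass f = ‖f‖ := by
  rw [mass_eq_integral, L1.norm_eq_integral_norm]
  refine integral_congr_ae ?_
  filter_upwards [(Lp.coeFn_nonneg f).2 hf] with x hx
  exact (Real.norm_of_nonneg hx).symm

/-- Additivity of the norm on the positive cone is the property special to `L¹` that turns mass
bookkeeping into norm identities. -/
theorem norm_add_of_nonneg {f g : L1 m} (hf : 0 ≤ f) (hg : 0 ≤ g) : ‖f + g‖ = ‖f‖ + ‖g‖ := by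
  rw [← mass_eq_norm hf, ← mass_eq_norm hg, ← mass_eq_norm (add_nonneg hf hg), map_add]

theorem norm_sub_of_le {f g : L1 m} (hf : 0 ≤ f) (hfg : f ≤ g) : ‖g - f‖ = ‖g‖ - ‖f‖ := by
  have := norm_add_of_nonneg (sub_nonneg.2 hfg) hf
  rw [sub_add_cancel] at this
  linarith

theorem norm_le_norm_of_le {f g : L1 m} (hf : 0 ≤ f) (hfg : f ≤ g) : ‖f‖ ≤ ‖g‖ := by
  linarith [norm_sub_of_le hf hfg, norm_nonneg (g - f)]

theorem norm_posPart_add_norm_negPart (f : L1 m) : ‖f⁺‖ + ‖f⁻‖ = ‖f‖ := by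
  rw [← norm_add_of_nonneg (posPart_nonneg f) (negPart_nonneg f), posPart_add_negPart,
    norm_abs_eq_norm]

/-- A bound for an additive map on the positive cone extends to all of `L¹`. -/
theorem norm_le_of_nonneg {Y : Type*} [NormedAddCommGroup Y] {T : L1 m →+ Y} {c : ℝ}
    (h : ∀ f, 0 ≤ f → ‖T f‖ ≤ c * ‖f‖) (f : L1 m) : ‖T f‖ ≤ c * ‖f‖ := by
  have h1 := norm_sub_le (T f⁺) (T f⁻)
  rw [← map_sub, posPart_sub_negPart] at h1
  rw [← norm_posPart_add_norm_negPart f, mul_add]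
  exact h1.trans (add_le_add (h _ (posPart_nonneg f)) (h _ (negPart_nonneg f)))

end Cone

/-! ### Substochastic semigroups -/

section Substochastic

variable {E : Type*} [MeasurableSpace E] {m : Measure E} {P : ℝ≥0 → L1 m →L[ℝ] L1 m}

theorem IsSubstochasticSemigroup.isContractionSemigroup (hP : IsSubstochasticSemigroup P) :
    IsContractionSemigroup P where
  map_zero := hP.1.map_zero
  map_add := hP.1.map_add
  continuous := hP.1.continuous
  norm_le t f := by
    simpa using norm_le_of_nonneg (T := (P t : L1 m →+ L1 m)) (c := 1)
      (fun g hg => by simpa using (hP.2 t g hg).2) f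

theorem IsSubstochasticSemigroup.laplace_nonneg (hP : IsSubstochasticSemigroup P) {lam : ℝ}
    {f : L1 m} (hf : 0 ≤ f) : 0 ≤ laplace P lam f :=
  IsContractionSemigroup.laplace_nonneg (fun t g hg => (hP.2 t g hg).1) hf

/-- The defect `‖f‖ - lam ‖laplace P lam f‖` is `lam` times the integral of the continuous
nonnegative function `e^{-lam t}(‖f‖ - ‖P(t) f‖)`, so it vanishes only if that function does. A
single `lam` thus decides stochasticity. -/
theorem IsSubstochasticSemigroup.isStochasticSemigroup_iff (hP : IsSubstochasticSemigroup P)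
    {lam : ℝ} (hlam : 0 < lam) :
    IsStochasticSemigroup P ↔ ∀ f, 0 ≤ f → lam * ‖laplace P lam f‖ = ‖f‖ := by
  have hC := hP.isContractionSemigroup
  have h1 : ∀ f, 0 ≤ f → ‖laplace P lam f‖ =
      ∫ t in Set.Ioi (0 : ℝ), Real.exp (-lam * t) * ‖P t.toNNReal f‖ := by
    intro f hf
    rw [← mass_eq_norm (hP.laplace_nonneg hf), laplace,
      ← mass.integral_comp_comm (hC.integrableOn_laplace hlam f)]
    refine integral_congr_ae (ae_of_all _ fun t => ?_)
    simp [mass_eq_norm (hP.2 t.toNNReal f hf).1]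
  have h2 : ∀ f : L1 m, lam * ∫ t in Set.Ioi (0 : ℝ), Real.exp (-lam * t) * ‖f‖ = ‖f‖ := by
    intro f
    rw [integral_mul_const, integral_exp_mul_Ioi (by linarith)]
    simp only [mul_zero, Real.exp_zero]
    field_simp
  constructor
  · intro hS f hf
    rw [h1 f hf]
    conv_rhs => rw [← h2 f]
    simp only [(hS.2 _ f hf).2]
  · intro h
    refine ⟨hP.1, fun t f hf => ⟨(hP.2 t f hf).1, ?_⟩⟩
    have hi1 := (exp_neg_integrableOn_Ioi 0 hlam).mul_const ‖f‖
    have hi2 : IntegrableOn (fun t : ℝ => Real.exp (-lam * t) * ‖P t.toNNReal f‖)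
        (Set.Ioi 0) := by
      refine (hC.integrableOn_laplace hlam f).norm.congr (ae_of_all _ fun t => ?_)
      simp [norm_smul]
    set d : ℝ → ℝ := fun t => Real.exp (-lam * t) * ‖f‖ - Real.exp (-lam * t) * ‖P t.toNNReal f‖
    have hd : 0 ≤ d := fun t => by
      simp only [d, ← mul_sub]
      exact mul_nonneg (Real.exp_pos _).le (sub_nonneg.2 (hC.norm_le _ _))
    have h3 : ∫ t in Set.Ioi (0 : ℝ), d t = 0 := by
      have := h f hf
      rw [← h2 f] at this
      rw [integral_sub hi1 hi2, ← h1 f hf, mul_left_cancel₀ hlam.ne' this, sub_self]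
    have h4 := (integral_eq_zero_iff_of_nonneg hd (hi1.sub hi2)).1 h3
    have hc : Continuous fun t : ℝ => P t.toNNReal f :=
      (hC.continuous f).comp continuous_real_toNNReal
    have he : Continuous fun t : ℝ => Real.exp (-lam * t) := by fun_prop
    have hdc : Continuous d := (he.mul continuous_const).sub (he.mul hc.norm)
    have h5 := Measure.eqOn_open_of_ae_eq h4 isOpen_Ioi hdc.continuousOn continuousOn_const
    rcases eq_or_ne t 0 with rfl | ht
    · simp [hC.map_zero]
    · have h6 := h5 (show (t : ℝ) ∈ Set.Ioi 0 from NNReal.coe_pos.2 (pos_iff_ne_zero.2 ht))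
      simp only [d, Real.toNNReal_coe, Pi.zero_apply, ← mul_sub] at h6
      have := (mul_eq_zero.1 h6).resolve_left (Real.exp_pos _).ne'
      linarith

end Substochastic

/-! ### The perturbation series -/

section Series

variable {E E' : Type*} [MeasurableSpace E] [MeasurableSpace E']
  {m : Measure E} {m' : Measure E'}
  (A : L1 m →ₗ.[ℝ] L1 m) (B : A.domain →ₗ[ℝ] L1 m) (Ψ₀ Ψ : A.domain →ₗ[ℝ] L1 m')

/-- The properties of `R(lam, A₀)` and `Ψ(lam)` on which the perturbation series rests. -/
structure IsAdmissible (lam : ℝ) : Prop where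
  pos : 0 < lam
  B_nonneg : IsPositiveOn B
  Psi_nonneg : IsPositiveOn Ψ
  mass_balance : ∀ f : A.domain, 0 ≤ (f : L1 m) →
    mass (A f) + mass (B f) + mass (Ψ f) = mass (Ψ₀ f)
  shift_resA0 : ∀ f, shift A lam (resA0 A Ψ₀ lam f) = f
  Psi0_resA0 : ∀ f, Ψ₀ (resA0 A Ψ₀ lam f) = 0
  resA0_nonneg : ∀ f, 0 ≤ f → 0 ≤ (resA0 A Ψ₀ lam f : L1 m)
  eq_zero : ∀ u : A.domain, shift A lam u = 0 → Ψ₀ u = 0 → u = 0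
  shift_dirichlet : ∀ g, shift A lam (dirichlet A Ψ₀ lam g) = 0
  dirichlet_nonneg : ∀ g, 0 ≤ g → 0 ≤ (dirichlet A Ψ₀ lam g : L1 m)
  Psi0_dirichlet_Psi0 : ∀ u, Ψ₀ (dirichlet A Ψ₀ lam (Ψ₀ u)) = Ψ₀ u
  Psi0_dirichlet_Psi : ∀ u, Ψ₀ (dirichlet A Ψ₀ lam (Ψ u)) = Ψ u

/-- The operator `(R(lam, A₀) B + Ψ(lam) Ψ)ⁿ R(lam, A₀)` on `L¹`. -/
def katoTerm (lam : ℝ) (n : ℕ) : L1 m →ₗ[ℝ] L1 m :=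
  A.domain.subtype ∘ₗ (stepOp A B Ψ₀ Ψ lam ^ n) ∘ₗ resA0 A Ψ₀ lam

/-- The sum of the perturbation series. -/
def kato (lam : ℝ) (f : L1 m) : L1 m := ∑' n, katoTerm A B Ψ₀ Ψ lam n f

/-- The partial sums of the perturbation series, as elements of `D`. -/
def katoSum (lam : ℝ) (f : L1 m) (N : ℕ) : A.domain :=
  ∑ n ∈ Finset.range (N + 1), (stepOp A B Ψ₀ Ψ lam ^ n) (resA0 A Ψ₀ lam f)

variable {A B Ψ₀ Ψ}

theorem coe_katoSum (lam : ℝ) (f : L1 m) (N : ℕ) : (katoSum A B Ψ₀ Ψ lam f N : L1 m) =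
    ∑ n ∈ Finset.range (N + 1), katoTerm A B Ψ₀ Ψ lam n f := by
  rw [katoSum, AddSubmonoidClass.coe_finsetSum]
  rfl

theorem katoSum_zero (lam : ℝ) (f : L1 m) : katoSum A B Ψ₀ Ψ lam f 0 = resA0 A Ψ₀ lam f := by
  simp [katoSum]

theorem katoSum_succ (lam : ℝ) (f : L1 m) (N : ℕ) : katoSum A B Ψ₀ Ψ lam f (N + 1) =
    resA0 A Ψ₀ lam f + stepOp A B Ψ₀ Ψ lam (katoSum A B Ψ₀ Ψ lam f N) := by
  rw [katoSum, Finset.sum_range_succ', katoSum, map_sum, add_comm]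
  simp [pow_succ']

namespace IsAdmissible

variable {lam mu : ℝ} (h : IsAdmissible A B Ψ₀ Ψ lam)
include h

theorem eq_of_shift {u v : A.domain} (h1 : shift A lam u = shift A lam v) (h2 : Ψ₀ u = Ψ₀ v) :
    u = v :=
  sub_eq_zero.1 (h.eq_zero _ (by rw [map_sub, h1, sub_self]) (by rw [map_sub, h2, sub_self]))

/-- Greiner's splitting of `D` into `D(A₀)` and `Ker(lam - A)`: both sides have the same image under
`lam - A` and under `Ψ₀`. -/
theorem decomposition (u : A.domain) :
    u = resA0 A Ψ₀ lam (shift A lam u) + dirichlet A Ψ₀ lam (Ψ₀ u) := by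
  refine h.eq_of_shift ?_ ?_
  · rw [map_add, h.shift_resA0, h.shift_dirichlet, add_zero]
  · rw [map_add, h.Psi0_resA0, h.Psi0_dirichlet_Psi0, zero_add]

theorem shift_stepOp (u : A.domain) : shift A lam (stepOp A B Ψ₀ Ψ lam u) = B u := by
  simp [stepOp, h.shift_resA0, h.shift_dirichlet]

theorem Psi0_stepOp (u : A.domain) : Ψ₀ (stepOp A B Ψ₀ Ψ lam u) = Ψ u := by
  simp [stepOp, h.Psi0_resA0, h.Psi0_dirichlet_Psi]

theorem stepOp_nonneg {u : A.domain} (hu : 0 ≤ (u : L1 m)) :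
    0 ≤ (stepOp A B Ψ₀ Ψ lam u : L1 m) :=
  add_nonneg (h.resA0_nonneg _ (h.B_nonneg u hu)) (h.dirichlet_nonneg _ (h.Psi_nonneg u hu))

theorem pow_stepOp_nonneg {u : A.domain} (hu : 0 ≤ (u : L1 m)) (n : ℕ) :
    0 ≤ ((stepOp A B Ψ₀ Ψ lam ^ n) u : L1 m) := by
  induction n with
  | zero => simpa
  | succ n ih => rw [pow_succ']; exact h.stepOp_nonneg ih

theorem norm_balance {u : A.domain} (hu : 0 ≤ (u : L1 m)) :
    lam * ‖(u : L1 m)‖ + (‖B u‖ + ‖Ψ u‖) = mass (shift A lam u) + mass (Ψ₀ u) := by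
  rw [← mass_eq_norm hu, ← mass_eq_norm (h.B_nonneg u hu), ← mass_eq_norm (h.Psi_nonneg u hu),
    ← h.mass_balance u hu, shift_apply, map_sub, map_smul, smul_eq_mul]
  ring

/-- `norm_balance` at `T^{N+1} w` has as its right side exactly the loss term of `T^N w`, so the sum
telescopes. -/
theorem sum_norm_pow_stepOp {w : A.domain} (hw : 0 ≤ (w : L1 m)) (N : ℕ) :
    lam * ∑ n ∈ Finset.range (N + 1), ‖((stepOp A B Ψ₀ Ψ lam ^ n) w : L1 m)‖ +
      (‖B ((stepOp A B Ψ₀ Ψ lam ^ N) w)‖ + ‖Ψ ((stepOp A B Ψ₀ Ψ lam ^ N) w)‖) =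
    mass (shift A lam w) + mass (Ψ₀ w) := by
  induction N with
  | zero => simpa using h.norm_balance hw
  | succ N ih =>
    have h0 := h.pow_stepOp_nonneg hw N
    have h1 := h.norm_balance (h.pow_stepOp_nonneg hw (N + 1))
    rw [pow_succ', Module.End.mul_apply, h.shift_stepOp, h.Psi0_stepOp,
      mass_eq_norm (h.B_nonneg _ h0), mass_eq_norm (h.Psi_nonneg _ h0)] at h1
    rw [Finset.sum_range_succ, mul_add, ← ih, pow_succ', Module.End.mul_apply]
    linarith

theorem summable_norm_pow_stepOp {w : A.domain} (hw : 0 ≤ (w : L1 m)) :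
    Summable fun n => ‖((stepOp A B Ψ₀ Ψ lam ^ n) w : L1 m)‖ := by
  refine summable_of_sum_range_le (c := lam⁻¹ * (mass (shift A lam w) + mass (Ψ₀ w)))
    (fun _ => norm_nonneg _) fun N => ?_
  refine (Finset.sum_le_sum_of_subset_of_nonneg (Finset.range_mono N.le_succ)
    fun _ _ _ => norm_nonneg _).trans ?_
  rw [← h.sum_norm_pow_stepOp hw N, mul_add, inv_mul_cancel_left₀ h.pos.ne']
  have := h.pos
  exact le_add_of_nonneg_right (by positivity)

/-- The positive part of `u` may leave `D`, so the data `(lam - A) u` and `Ψ₀ u` are split into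
positive and negative parts instead; this writes `u` through positive elements of `D`. -/
theorem tendsto_pow_stepOp (u : A.domain) :
    Tendsto (fun n => ((stepOp A B Ψ₀ Ψ lam ^ n) u : L1 m)) atTop (𝓝 0) := by
  have hpos : ∀ w : A.domain, 0 ≤ (w : L1 m) →
      Tendsto (fun n => ((stepOp A B Ψ₀ Ψ lam ^ n) w : L1 m)) atTop (𝓝 0) := fun w hw =>
    tendsto_zero_iff_norm_tendsto_zero.2 (h.summable_norm_pow_stepOp hw).tendsto_atTop_zero
  set f := shift A lam u
  set g := Ψ₀ u
  have hu : u = (resA0 A Ψ₀ lam f⁺ - resA0 A Ψ₀ lam f⁻) +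
      (dirichlet A Ψ₀ lam g⁺ - dirichlet A Ψ₀ lam g⁻) := by
    rw [← map_sub, ← map_sub, posPart_sub_negPart, posPart_sub_negPart]
    exact h.decomposition u
  have h1 := ((hpos _ (h.resA0_nonneg _ (posPart_nonneg f))).sub
      (hpos _ (h.resA0_nonneg _ (negPart_nonneg f)))).add
    ((hpos _ (h.dirichlet_nonneg _ (posPart_nonneg g))).sub
      (hpos _ (h.dirichlet_nonneg _ (negPart_nonneg g))))
  rw [hu]
  simpa using h1

theorem katoTerm_nonneg (n : ℕ) {f : L1 m} (hf : 0 ≤ f) : 0 ≤ katoTerm A B Ψ₀ Ψ lam n f :=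
  h.pow_stepOp_nonneg (h.resA0_nonneg f hf) n

theorem sum_norm_katoTerm {f : L1 m} (hf : 0 ≤ f) (N : ℕ) :
    lam * ∑ n ∈ Finset.range (N + 1), ‖katoTerm A B Ψ₀ Ψ lam n f‖ +
      (‖B ((stepOp A B Ψ₀ Ψ lam ^ N) (resA0 A Ψ₀ lam f))‖ +
        ‖Ψ ((stepOp A B Ψ₀ Ψ lam ^ N) (resA0 A Ψ₀ lam f))‖) = ‖f‖ := by
  have := h.sum_norm_pow_stepOp (h.resA0_nonneg f hf) N
  rwa [h.shift_resA0, h.Psi0_resA0, map_zero, add_zero, mass_eq_norm hf] at this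

theorem summable_norm_katoTerm (f : L1 m) : Summable fun n => ‖katoTerm A B Ψ₀ Ψ lam n f‖ := by
  have hpos : ∀ f, 0 ≤ f → Summable fun n => ‖katoTerm A B Ψ₀ Ψ lam n f‖ := fun f hf =>
    h.summable_norm_pow_stepOp (h.resA0_nonneg f hf)
  refine Summable.of_nonneg_of_le (fun _ => norm_nonneg _) (fun n => ?_)
    ((hpos _ (posPart_nonneg f)).add (hpos _ (negPart_nonneg f)))
  conv_lhs => rw [← posPart_sub_negPart f, map_sub]
  exact norm_sub_le _ _

theorem hasSum_kato (f : L1 m) :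
    HasSum (fun n => katoTerm A B Ψ₀ Ψ lam n f) (kato A B Ψ₀ Ψ lam f) :=
  (h.summable_norm_katoTerm f).of_norm.hasSum

theorem tendsto_katoSum (f : L1 m) :
    Tendsto (fun N => (katoSum A B Ψ₀ Ψ lam f N : L1 m)) atTop (𝓝 (kato A B Ψ₀ Ψ lam f)) := by
  simp only [coe_katoSum]
  exact (h.hasSum_kato f).tendsto_sum_nat.comp (tendsto_add_atTop_nat 1)

theorem katoSum_nonneg {f : L1 m} (hf : 0 ≤ f) (N : ℕ) :
    0 ≤ (katoSum A B Ψ₀ Ψ lam f N : L1 m) := by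
  rw [coe_katoSum]
  exact Finset.sum_nonneg fun n _ => h.katoTerm_nonneg n hf

theorem kato_nonneg {f : L1 m} (hf : 0 ≤ f) : 0 ≤ kato A B Ψ₀ Ψ lam f :=
  tsum_nonneg fun n => h.katoTerm_nonneg n hf

theorem katoSum_le_kato {f : L1 m} (hf : 0 ≤ f) (N : ℕ) :
    (katoSum A B Ψ₀ Ψ lam f N : L1 m) ≤ kato A B Ψ₀ Ψ lam f := by
  rw [coe_katoSum]
  exact sum_le_hasSum _ (fun n _ => h.katoTerm_nonneg n hf) (h.hasSum_kato f)

theorem norm_katoSum {f : L1 m} (hf : 0 ≤ f) (N : ℕ) : ‖(katoSum A B Ψ₀ Ψ lam f N : L1 m)‖ =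
    ∑ n ∈ Finset.range (N + 1), ‖katoTerm A B Ψ₀ Ψ lam n f‖ := by
  rw [← mass_eq_norm (h.katoSum_nonneg hf N), coe_katoSum, map_sum]
  exact Finset.sum_congr rfl fun n _ => mass_eq_norm (h.katoTerm_nonneg n hf)

theorem tendsto_loss {f : L1 m} (hf : 0 ≤ f) : Tendsto (fun N =>
    ‖B ((stepOp A B Ψ₀ Ψ lam ^ N) (resA0 A Ψ₀ lam f))‖ +
      ‖Ψ ((stepOp A B Ψ₀ Ψ lam ^ N) (resA0 A Ψ₀ lam f))‖) atTop
    (𝓝 (‖f‖ - lam * ‖kato A B Ψ₀ Ψ lam f‖)) := by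
  refine (((h.tendsto_katoSum f).norm.const_mul lam).const_sub ‖f‖).congr fun N => ?_
  rw [h.norm_katoSum hf, ← h.sum_norm_katoTerm hf N, add_sub_cancel_left]

theorem norm_kato_eq_iff {f : L1 m} (hf : 0 ≤ f) : lam * ‖kato A B Ψ₀ Ψ lam f‖ = ‖f‖ ↔
    Tendsto (fun N => ‖B ((stepOp A B Ψ₀ Ψ lam ^ N) (resA0 A Ψ₀ lam f))‖ +
      ‖Ψ ((stepOp A B Ψ₀ Ψ lam ^ N) (resA0 A Ψ₀ lam f))‖) atTop (𝓝 0) := by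
  have := h.tendsto_loss hf
  constructor
  · intro he
    rwa [he, sub_self] at this
  · intro he
    linarith [tendsto_nhds_unique this he]

theorem lam_mul_norm_kato_le {f : L1 m} (hf : 0 ≤ f) : lam * ‖kato A B Ψ₀ Ψ lam f‖ ≤ ‖f‖ :=
  sub_nonneg.1 (ge_of_tendsto' (h.tendsto_loss hf) fun _ => by positivity)

/-- The sum of the perturbation series as a continuous linear map. -/
def katoL : L1 m →L[ℝ] L1 m :=
  let T : L1 m →ₗ[ℝ] L1 m :=
    { toFun := kato A B Ψ₀ Ψ lam
      map_add' := fun f g => (h.hasSum_kato (f + g)).unique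
        (by simpa using (h.hasSum_kato f).add (h.hasSum_kato g))
      map_smul' := fun c f => (h.hasSum_kato (c • f)).unique
        (by simpa using (h.hasSum_kato f).const_smul c) }
  T.mkContinuous lam⁻¹ <| norm_le_of_nonneg (T := T.toAddMonoidHom) fun f hf => by
    rw [← div_eq_inv_mul, le_div_iff₀' h.pos]
    exact h.lam_mul_norm_kato_le hf

theorem katoL_apply (f : L1 m) : h.katoL f = kato A B Ψ₀ Ψ lam f := rfl

/-- `B` and `Ψ` may be unbounded; the bound comes from positivity, each term being dominated by the
whole sum. -/
theorem continuous_katoTerm (n : ℕ) : Continuous (katoTerm A B Ψ₀ Ψ lam n) := by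
  refine AddMonoidHomClass.continuous_of_bound (katoTerm A B Ψ₀ Ψ lam n) lam⁻¹
    (norm_le_of_nonneg (T := (katoTerm A B Ψ₀ Ψ lam n).toAddMonoidHom) fun f hf => ?_)
  refine (norm_le_norm_of_le (h.katoTerm_nonneg n hf)
    (le_hasSum (h.hasSum_kato f) n fun k _ => h.katoTerm_nonneg k hf)).trans ?_
  rw [← div_eq_inv_mul, le_div_iff₀' h.pos]
  exact h.lam_mul_norm_kato_le hf

theorem norm_katoL_le (f : L1 m) : ‖h.katoL f‖ ≤ lam⁻¹ * ‖f‖ :=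
  norm_le_of_nonneg (T := (h.katoL : L1 m →+ L1 m)) (fun f hf => by
    rw [← div_eq_inv_mul, le_div_iff₀' h.pos]
    exact h.lam_mul_norm_kato_le hf) f

theorem shift_katoSum_succ (f : L1 m) (N : ℕ) : shift A lam (katoSum A B Ψ₀ Ψ lam f (N + 1)) =
    f + B (katoSum A B Ψ₀ Ψ lam f N) := by
  rw [katoSum_succ, map_add, h.shift_resA0, h.shift_stepOp]

theorem Psi0_katoSum_succ (f : L1 m) (N : ℕ) : Ψ₀ (katoSum A B Ψ₀ Ψ lam f (N + 1)) =
    Ψ (katoSum A B Ψ₀ Ψ lam f N) := by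
  rw [katoSum_succ, map_add, h.Psi0_resA0, h.Psi0_stepOp, zero_add]

omit h in
theorem shift_eq_add (u : A.domain) : shift A mu u = shift A lam u + (mu - lam) • (u : L1 m) := by
  simp only [shift_apply]; module

/-- With `S_N` the partial sums for `lam`, `(mu - A) S_{N+1} = f + (mu - lam) S_{N+1} + B S_N` and
`Ψ₀ S_{N+1} = Ψ S_N`. Solving with the operators at `mu` and unrolling the recursion gives the
convolution, a discrete resolvent identity. -/
theorem katoSum_eq_sum (h' : IsAdmissible A B Ψ₀ Ψ mu) (f : L1 m) (N : ℕ) :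
    katoSum A B Ψ₀ Ψ lam f N = ∑ k ∈ Finset.range (N + 1), (stepOp A B Ψ₀ Ψ mu ^ k)
      (resA0 A Ψ₀ mu (f + (mu - lam) • (katoSum A B Ψ₀ Ψ lam f (N - k) : L1 m))) := by
  induction N with
  | zero =>
    simp only [zero_add, Finset.sum_range_one, pow_zero, Module.End.one_apply, katoSum_zero]
    refine h'.eq_of_shift ?_ ?_
    · rw [h'.shift_resA0, shift_eq_add (lam := lam), h.shift_resA0, Nat.sub_self,
        katoSum_zero]
    · rw [h.Psi0_resA0, h'.Psi0_resA0]
  | succ N ih =>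
    rw [Finset.sum_range_succ']
    simp only [Nat.add_sub_add_right, pow_succ', Module.End.mul_apply, pow_zero,
      Module.End.one_apply, Nat.sub_zero]
    rw [← map_sum, ← ih]
    refine h'.eq_of_shift ?_ ?_
    · rw [map_add, h'.shift_resA0, h'.shift_stepOp, shift_eq_add (lam := lam),
        h.shift_katoSum_succ]
      abel
    · rw [map_add, h'.Psi0_resA0, h'.Psi0_stepOp, h.Psi0_katoSum_succ, add_zero]

theorem katoL_resolvent_eq (h' : IsAdmissible A B Ψ₀ Ψ mu) (f : L1 m) :
    h.katoL f = h'.katoL f + (mu - lam) • h'.katoL (h.katoL f) := by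
  suffices hpos : ∀ f, 0 ≤ f → h.katoL f = h'.katoL f + (mu - lam) • h'.katoL (h.katoL f) by
    have h1 := hpos _ (posPart_nonneg f)
    have h2 := hpos _ (negPart_nonneg f)
    rw [← posPart_sub_negPart f]
    simp only [map_sub]
    conv_lhs => rw [h1, h2]
    rw [smul_sub]
    abel
  intro f hf
  -- Extension by zero beyond `N` makes the index set fixed. For `f ≥ 0` the partial sums lie below
  -- the full sum, which supplies the dominating series.
  have h1 : ∀ N, (katoSum A B Ψ₀ Ψ lam f N : L1 m) = katoSum A B Ψ₀ Ψ mu f N +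
      (mu - lam) • ∑' k, if k ≤ N then
        katoTerm A B Ψ₀ Ψ mu k (katoSum A B Ψ₀ Ψ lam f (N - k)) else 0 := by
    intro N
    rw [tsum_eq_sum (s := Finset.range (N + 1)) (fun k hk => if_neg (by simpa using hk)),
      coe_katoSum mu, Finset.smul_sum, ← Finset.sum_add_distrib]
    conv_lhs => rw [h.katoSum_eq_sum h', AddSubmonoidClass.coe_finsetSum]
    refine Finset.sum_congr rfl fun k hk => ?_
    rw [if_pos (by simpa [Nat.lt_succ_iff] using hk), ← map_smul, ← map_add]
    rfl
  have h2 : Tendsto (fun N => ∑' k, if k ≤ N then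
      katoTerm A B Ψ₀ Ψ mu k (katoSum A B Ψ₀ Ψ lam f (N - k)) else 0) atTop
      (𝓝 (∑' k, katoTerm A B Ψ₀ Ψ mu k (kato A B Ψ₀ Ψ lam f))) := by
    refine tendsto_tsum_of_dominated_convergence
      (h'.summable_norm_katoTerm (kato A B Ψ₀ Ψ lam f)) (fun k => ?_)
      (Eventually.of_forall fun N k => ?_)
    · refine ((((h'.continuous_katoTerm k).tendsto _).comp (h.tendsto_katoSum f)).comp
        (tendsto_sub_atTop_nat k)).congr' ?_
      filter_upwards [eventually_ge_atTop k] with N hN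
      simp [hN]
    · split_ifs
      · refine norm_le_norm_of_le (h'.katoTerm_nonneg k (h.katoSum_nonneg hf _)) ?_
        rw [← sub_nonneg, ← map_sub]
        exact h'.katoTerm_nonneg k (sub_nonneg.2 (h.katoSum_le_kato hf _))
      · simp
  refine tendsto_nhds_unique (h.tendsto_katoSum f) ?_
  exact ((h'.tendsto_katoSum f).add (h2.const_smul _)).congr fun N => (h1 N).symm

/-- Elements of `D` with `Ψ₀ u = Ψ u` are recovered by the perturbation series. -/
theorem kato_shift_sub {u : A.domain} (hu : Ψ₀ u = Ψ u) :
    kato A B Ψ₀ Ψ lam (shift A lam u - B u) = u := by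
  -- So `u = R(lam, A₀)(lam - A - B) u + T u`; iteration leaves the remainder `T^{N+1} u`, which
  -- tends to zero.
  have h0 : u = resA0 A Ψ₀ lam (shift A lam u - B u) + stepOp A B Ψ₀ Ψ lam u := by
    conv_lhs => rw [h.decomposition u]
    simp only [map_sub, stepOp, LinearMap.add_apply, LinearMap.comp_apply, hu]
    abel
  have h1 : ∀ N, katoSum A B Ψ₀ Ψ lam (shift A lam u - B u) N =
      u - (stepOp A B Ψ₀ Ψ lam ^ (N + 1)) u := by
    intro N
    induction N with
    | zero => rw [katoSum_zero, zero_add, pow_one]; exact eq_sub_of_add_eq h0.symm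
    | succ N ih =>
      rw [katoSum_succ, ih, map_sub (stepOp A B Ψ₀ Ψ lam), ← add_sub_assoc, ← h0, pow_succ' _ (N + 1)]
      rfl
  refine tendsto_nhds_unique (h.tendsto_katoSum _) ?_
  have h2 := ((h.tendsto_pow_stepOp u).comp (tendsto_add_atTop_nat 1)).const_sub (u : L1 m)
  rw [sub_zero] at h2
  refine h2.congr fun N => ?_
  rw [h1 N]
  rfl

end IsAdmissible

end Series

/-! ### Restrictions of the maximal operator -/

section Restriction

variable {X Y Z : Type*} [AddCommGroup X] [Module ℝ X] [AddCommGroup Y] [Module ℝ Y]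
  [AddCommGroup Z] [Module ℝ Z]

theorem apply_inclKer (T : X →ₗ.[ℝ] Y) (Φ : T.domain →ₗ[ℝ] Z) (x : (restrictKer T Φ).domain) :
    Φ (inclKer T Φ x) = 0 := by
  obtain ⟨_, h⟩ := (mem_restrictKer_domain T Φ x).1 x.2
  exact h

theorem exists_inclKer_eq {T : X →ₗ.[ℝ] Y} {Φ : T.domain →ₗ[ℝ] Z} {u : T.domain} (hu : Φ u = 0) :
    ∃ x, inclKer T Φ x = u :=
  ⟨⟨u, (mem_restrictKer_domain T Φ u).2 ⟨u.2, hu⟩⟩, rfl⟩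

theorem shift_inclKer (T : X →ₗ.[ℝ] X) (Φ : T.domain →ₗ[ℝ] Z) (lam : ℝ)
    (x : (restrictKer T Φ).domain) :
    shift T lam (inclKer T Φ x) = shift (restrictKer T Φ) lam x := rfl

end Restriction

/-! ### Operators whose powers tend to zero -/

section Powers

variable {X : Type*} [NormedAddCommGroup X] [NormedSpace ℝ X] {T : Module.End ℝ X}

theorem PowersTendToZero.eq_zero_of_apply_eq (hT : PowersTendToZero T) {x : X} (hx : T x = x) :
    x = 0 := by
  obtain ⟨N, hN⟩ := hT (1 / 2) (by norm_num)
  have h := hN N le_rfl x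
  rw [Module.End.pow_apply, Function.iterate_fixed hx] at h
  exact norm_le_zero_iff.1 (by linarith)

/-- A Neumann argument for some power: `1 - T^N` is invertible once `‖T^N‖ ≤ 1/2`, and it factors as
`(1 - T) ∑ Tⁱ`. Continuity of `T` itself is not needed. -/
theorem PowersTendToZero.exists_sub_apply_eq [CompleteSpace X] (hT : PowersTendToZero T) (y : X) :
    ∃ x, x - T x = y := by
  obtain ⟨N, hN⟩ := hT (1 / 2) (by norm_num)
  let S : X →L[ℝ] X := (T ^ N).mkContinuous (1 / 2) (hN N le_rfl)
  have hS : ‖S‖ < 1 :=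
    (LinearMap.mkContinuous_norm_le _ (by norm_num) _).trans_lt (by norm_num)
  obtain ⟨V, hV⟩ := (isUnit_one_sub_of_norm_lt_one hS).exists_right_inv
  have hz : V y - (T ^ N) (V y) = y := congrArg (fun W : X →L[ℝ] X => W y) hV
  refine ⟨(∑ i ∈ Finset.range N, T ^ i) (V y), ?_⟩
  have h := congrArg (fun W : Module.End ℝ X => W (V y)) (mul_neg_geom_sum T N)
  exact h.trans hz

end Powers

/-! ### Admissibility of the data, construction of the semigroup, and the two criteria. -/

section Admissible

variable {E E' : Type*} [MeasurableSpace E] [MeasurableSpace E']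
  {m : Measure E} {m' : Measure E'}
  {A : L1 m →ₗ.[ℝ] L1 m} {B : A.domain →ₗ[ℝ] L1 m} {Ψ₀ Ψ : A.domain →ₗ[ℝ] L1 m'}

theorem coe_resA0_eq_laplace {S : ℝ≥0 → L1 m →L[ℝ] L1 m} (hS : IsSubstochasticSemigroup S)
    (hG : IsGenerator S (opA0 A Ψ₀)) {lam : ℝ} (hlam : 0 < lam) (f : L1 m) :
    (resA0 A Ψ₀ lam f : L1 m) = laplace S lam f :=
  resolvent_eq_laplace hS.isContractionSemigroup hG hlam f

/-- The right-inverse property is required only on the ranges of `Ψ₀` and `Ψ`; in the degenerate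
case `Ψ₀ = Ψ = 0`, `Ψ(lam) = 0` it therefore holds trivially, and both cases are treated alike
afterwards. -/
theorem isAdmissible_of_generator (hB : IsPositiveOn B) (hΨ : IsPositiveOn Ψ)
    (hdeg : Ψ₀ = 0 → Ψ = 0)
    {S : ℝ≥0 → L1 m →L[ℝ] L1 m} (hS : IsSubstochasticSemigroup S)
    (hG : IsGenerator S (opA0 A Ψ₀))
    (hinv : Ψ₀ ≠ 0 → ∀ lam : ℝ, 0 < lam → ∃ Φ, IsPositiveRightInverse A Ψ₀ lam Φ)
    (hmass : ∀ f : A.domain, 0 ≤ (f : L1 m) →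
      (∫ x, (A f + B f) x ∂m) + (∫ x, (Ψ f - Ψ₀ f) x ∂m') = 0)
    {lam : ℝ} (hlam : 0 < lam) : IsAdmissible A B Ψ₀ Ψ lam := by
  have hbij : Function.Bijective (shift (opA0 A Ψ₀) lam) :=
    bijective_shift hS.isContractionSemigroup hG hlam
  have hdir : (∀ g, shift A lam (dirichlet A Ψ₀ lam g) = 0) ∧
      (∀ g, 0 ≤ g → 0 ≤ (dirichlet A Ψ₀ lam g : L1 m)) ∧
      ((∀ g, Ψ₀ (dirichlet A Ψ₀ lam g) = g) ∨ (Ψ₀ = 0 ∧ Ψ = 0)) := by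
    by_cases h : ∃ Φ, IsPositiveRightInverse A Ψ₀ lam Φ
    · have hd : dirichlet A Ψ₀ lam = h.choose := dif_pos h
      rw [hd]
      exact ⟨h.choose_spec.mem_ker, h.choose_spec.nonneg, Or.inl h.choose_spec.right_inv⟩
    · have hd : dirichlet A Ψ₀ lam = 0 := dif_neg h
      have h0 : Ψ₀ = 0 := by
        by_contra hne
        exact h (hinv hne lam hlam)
      exact ⟨fun g => by simp [hd], fun g _ => by simp [hd], Or.inr ⟨h0, hdeg h0⟩⟩
  obtain ⟨hd1, hd2, hd3⟩ := hdir
  refine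
    { pos := hlam
      B_nonneg := hB
      Psi_nonneg := hΨ
      mass_balance := fun f hf => ?_
      shift_resA0 := shift_resolvent _ _ hbij
      Psi0_resA0 := fun f => apply_inclKer A Ψ₀ _
      resA0_nonneg := fun f hf => ?_
      eq_zero := fun u hu hu0 => ?_
      shift_dirichlet := hd1
      dirichlet_nonneg := hd2
      Psi0_dirichlet_Psi0 := fun u => ?_
      Psi0_dirichlet_Psi := fun u => ?_ }
  · have h := hmass f hf
    rw [← mass_eq_integral, ← mass_eq_integral, map_add, map_sub] at h
    linarith
  · rw [coe_resA0_eq_laplace hS hG hlam]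
    exact hS.laplace_nonneg hf
  · obtain ⟨x, rfl⟩ := exists_inclKer_eq hu0
    rw [shift_inclKer] at hu
    have hx : x = 0 := hbij.1 (hu.trans (map_zero (shift (opA0 A Ψ₀) lam)).symm)
    rw [hx, map_zero]
  · rcases hd3 with h | ⟨h, -⟩
    · exact h _
    · simp [h]
  · rcases hd3 with h | ⟨h, h'⟩
    · exact h _
    · simp [h, h']

theorem mem_graph_opAPsiB {f g : L1 m} : (f, g) ∈ (opAPsiB A B Ψ₀ Ψ).graph ↔
    ∃ u : A.domain, Ψ₀ u = Ψ u ∧ (u : L1 m) = f ∧ A u + B u = g := by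
  rw [LinearPMap.mem_graph_iff]
  constructor
  · rintro ⟨x, hx, hx'⟩
    exact ⟨inclKer A (Ψ₀ - Ψ) x, sub_eq_zero.1 (apply_inclKer A (Ψ₀ - Ψ) x), hx, hx'⟩
  · rintro ⟨u, hu, hf, hg⟩
    obtain ⟨x, rfl⟩ := exists_inclKer_eq (T := A) (Φ := Ψ₀ - Ψ) (sub_eq_zero.2 hu)
    exact ⟨x, hf, hg⟩

section Family

variable (h : ∀ ⦃lam : ℝ⦄, 0 < lam → IsAdmissible A B Ψ₀ Ψ lam)
  (hlim : ∀ f, Tendsto (fun lam : ℝ => lam • (resA0 A Ψ₀ lam f : L1 m)) atTop (𝓝 f))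
include h hlim

/-- For `f ≥ 0`, `R(lam, A₀) f ≤ R(lam) f`, so additivity of the norm bounds the distance of `lam
R(lam) f` from `lam R(lam, A₀) f` by `‖f‖ - ‖lam R(lam, A₀) f‖`, which tends to zero. -/
theorem tendsto_smul_kato (f : L1 m) :
    Tendsto (fun lam : ℝ => lam • kato A B Ψ₀ Ψ lam f) atTop (𝓝 f) := by
  have hpos : ∀ f, 0 ≤ f → Tendsto (fun lam : ℝ => lam • kato A B Ψ₀ Ψ lam f) atTop (𝓝 f) := by
    intro f hf
    have h1 : Tendsto (fun lam : ℝ =>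
        lam • kato A B Ψ₀ Ψ lam f - lam • (resA0 A Ψ₀ lam f : L1 m)) atTop (𝓝 0) := by
      have h2 := (hlim f).norm.const_sub ‖f‖
      rw [sub_self] at h2
      refine squeeze_zero_norm' ?_ h2
      filter_upwards [eventually_gt_atTop 0] with lam hlam
      have h3 : (resA0 A Ψ₀ lam f : L1 m) ≤ kato A B Ψ₀ Ψ lam f := by
        simpa [katoSum_zero] using (h hlam).katoSum_le_kato hf 0
      rw [← smul_sub, norm_smul, norm_smul, Real.norm_of_nonneg hlam.le,
        norm_sub_of_le ((h hlam).resA0_nonneg f hf) h3, mul_sub]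
      exact sub_le_sub_right ((h hlam).lam_mul_norm_kato_le hf) _
    simpa using h1.add (hlim f)
  have h1 := (hpos _ (posPart_nonneg f)).sub (hpos _ (negPart_nonneg f))
  rw [posPart_sub_negPart] at h1
  refine h1.congr' ?_
  filter_upwards [eventually_gt_atTop 0] with lam hlam
  rw [← smul_sub]
  congr 1
  have := map_sub (h hlam).katoL f⁺ f⁻
  rw [posPart_sub_negPart] at this
  exact this.symm

open Classical in
theorem exists_isContractionResolvent : ∃ R : ℝ → L1 m →L[ℝ] L1 m, IsContractionResolvent R ∧
    ∀ lam, 0 < lam → ∀ f, R lam f = kato A B Ψ₀ Ψ lam f := by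
  let R : ℝ → L1 m →L[ℝ] L1 m := fun lam =>
    if hlam : 0 < lam then (h hlam).katoL else 0
  have hR : ∀ ⦃lam⦄ (hlam : 0 < lam), R lam = (h hlam).katoL := fun lam hlam => dif_pos hlam
  refine ⟨R, ⟨?_, ?_, ?_⟩, ?_⟩
  · intro lam mu hlam hmu f
    rw [hR hlam, hR hmu]
    exact (h hlam).katoL_resolvent_eq (h hmu) f
  · intro lam hlam f
    rw [hR hlam]
    exact (h hlam).norm_katoL_le f
  · intro f
    refine (tendsto_smul_kato h hlim f).congr' ?_
    filter_upwards [eventually_gt_atTop 0] with lam hlam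
    rw [hR hlam, (h hlam).katoL_apply]
  · intro lam hlam f
    rw [hR hlam, (h hlam).katoL_apply]

theorem exists_isPerturbedSemigroup : ∃ P, IsPerturbedSemigroup A B Ψ₀ Ψ P := by
  obtain ⟨R, hR, hRk⟩ := exists_isContractionResolvent h hlim
  have hP := hR.isContractionSemigroup
  obtain ⟨G, hG⟩ := exists_generator hR.semigroup
  refine ⟨hR.semigroup, ⟨⟨hP.map_zero, hP.map_add, hP.continuous⟩, fun t f hf =>
    ⟨hR.semigroup_nonneg (fun lam hlam g hg => ?_) t hf, hP.norm_le t f⟩⟩, G, hG, ?_, ?_⟩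
  · rw [hRk lam hlam]
    exact (h hlam).kato_nonneg hg
  · rw [← LinearPMap.le_graph_iff]
    rintro ⟨f, g⟩ hfg
    obtain ⟨u, hu, rfl, rfl⟩ := mem_graph_opAPsiB.1 hfg
    rw [hG, hR.hasOrbitDeriv_semigroup_iff, hRk 1 one_pos]
    have := (h one_pos).kato_shift_sub hu
    rwa [shift_apply, one_smul, sub_sub] at this
  · intro lam hlam
    refine ⟨inResolventSet hP hG hlam, fun f => ?_⟩
    -- The generator is known through `R 1` only; the resolvent identity places `R lam f` in its
    -- domain.
    have h1 : HasOrbitDeriv hR.semigroup (R lam f) (lam • R lam f - f) := by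
      rw [hR.hasOrbitDeriv_semigroup_iff]
      conv_rhs => rw [hR.resolvent_eq hlam one_pos f, ← map_smul, ← map_add]
      congr 1
      module
    have h2 := hP.laplace_of_hasOrbitDeriv hlam h1
    rw [sub_sub_cancel] at h2
    rw [resolvent_eq_laplace hP hG hlam, h2, hRk lam hlam]
    exact ((h hlam).tendsto_katoSum f).congr fun N => coe_katoSum lam f N

end Family

theorem IsPerturbedSemigroup.laplace_eq {P : ℝ≥0 → L1 m →L[ℝ] L1 m}
    (hP : IsPerturbedSemigroup A B Ψ₀ Ψ P) {lam : ℝ} (h : IsAdmissible A B Ψ₀ Ψ lam) (f : L1 m) :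
    laplace P lam f = kato A B Ψ₀ Ψ lam f := by
  obtain ⟨hS, G, hG, -, hres⟩ := hP
  rw [← resolvent_eq_laplace hS.isContractionSemigroup hG h.pos]
  exact tendsto_nhds_unique ((hres lam h.pos).2 f)
    ((h.tendsto_katoSum f).congr fun N => coe_katoSum lam f N)

namespace IsAdmissible

variable {lam : ℝ} (h : IsAdmissible A B Ψ₀ Ψ lam)
include h

/-! ### The operator matrix on `L¹ × L¹_∂` -/

/-- `lam - 𝒜` maps `(u, 0)` to `((lam - A) u, Ψ₀ u)`. The argument lies in its range, so injectivity
suffices and the degenerate case is included. -/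
theorem calBR_apply (u : A.domain) :
    calBR A B Ψ₀ Ψ lam (shift A lam u, Ψ₀ u) = (B u, Ψ u) := by
  have key : ∀ z : (calA A Ψ₀).domain, shift (calA A Ψ₀) lam z =
      (shift A lam (projD A z), Ψ₀ (projD A z)) := by
    intro z
    have h2 : (z : L1 m × L1 m').2 = 0 := z.2.2
    refine Prod.ext rfl ?_
    change lam • (z : L1 m × L1 m').2 - -Ψ₀ (projD A z) = Ψ₀ (projD A z)
    rw [h2, smul_zero, zero_sub, neg_neg]
  have hinj : Function.Injective (shift (calA A Ψ₀) lam) := by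
    rw [injective_iff_map_eq_zero]
    intro z hz
    rw [key z, Prod.mk_eq_zero] at hz
    have h1 := h.eq_zero _ hz.1 hz.2
    exact Subtype.ext (Prod.ext (congrArg Subtype.val h1) z.2.2)
  let z : (calA A Ψ₀).domain := ⟨((u : L1 m), 0), u.2, rfl⟩
  have hz : projD A z = u := rfl
  have h1 := resolvent_shift (calA A Ψ₀) lam hinj z
  rw [key z, hz] at h1
  rw [calBR, LinearMap.comp_apply, h1]
  rfl

/-- The pair `(B u, Ψ u)` is the data of `T u`, so a further factor `ℬ R(lam, 𝒜)` advances `u` to `T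
u`. The first factor is spent on `(f, 0)`, the data of `R(lam, A₀) f`; hence the exponent `n + 1`.
-/
theorem calBR_pow_succ (f : L1 m) (n : ℕ) : (calBR A B Ψ₀ Ψ lam ^ (n + 1)) (f, 0) =
    (B ((stepOp A B Ψ₀ Ψ lam ^ n) (resA0 A Ψ₀ lam f)),
      Ψ ((stepOp A B Ψ₀ Ψ lam ^ n) (resA0 A Ψ₀ lam f))) := by
  induction n with
  | zero =>
    have := h.calBR_apply (resA0 A Ψ₀ lam f)
    rw [h.shift_resA0, h.Psi0_resA0] at this
    simpa using this
  | succ n ih =>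
    rw [pow_succ', Module.End.mul_apply, ih, ← h.shift_stepOp, ← h.Psi0_stepOp, h.calBR_apply,
      pow_succ', Module.End.mul_apply]

theorem isStochasticSemigroup_iff {P : ℝ≥0 → L1 m →L[ℝ] L1 m}
    (hP : IsPerturbedSemigroup A B Ψ₀ Ψ P) : IsStochasticSemigroup P ↔ ∀ f : L1 m, 0 ≤ f →
      Tendsto (fun n : ℕ => sumNorm ((calBR A B Ψ₀ Ψ lam ^ n) (f, 0))) atTop (𝓝 0) := by
  rw [hP.1.isStochasticSemigroup_iff h.pos]
  refine forall₂_congr fun f hf => ?_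
  rw [hP.laplace_eq h, h.norm_kato_eq_iff hf, ← tendsto_add_atTop_iff_nat
    (f := fun n : ℕ => sumNorm ((calBR A B Ψ₀ Ψ lam ^ n) (f, 0))) 1]
  simp only [h.calBR_pow_succ, sumNorm]

/-! ### Exactness of the generator -/

/-- A kernel element satisfies `u = Ψ(lam) Ψ u`, making `Ψ u` a fixed point of `Ψ Ψ(lam)`, hence
zero. For surjectivity, `u = R(lam, A₀) f + Ψ(lam) g` meets the boundary condition once `g - Ψ
Ψ(lam) g = Ψ R(lam, A₀) f`. -/
theorem bijective_shift_opAPsi (hΨ : PowersTendToZero (opPsiPsi A Ψ₀ Ψ lam)) :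
    Function.Bijective (shift (opAPsi A Ψ₀ Ψ) lam) := by
  constructor
  · rw [injective_iff_map_eq_zero]
    intro x hx
    set u := inclKer A (Ψ₀ - Ψ) x with hu
    have hu1 : shift A lam u = 0 := hx
    have hu2 : Ψ₀ u = Ψ u := sub_eq_zero.1 (apply_inclKer A (Ψ₀ - Ψ) x)
    have hu3 : u = dirichlet A Ψ₀ lam (Ψ u) := by
      have := h.decomposition u
      rwa [hu1, map_zero, zero_add, hu2] at this
    have hu4 : Ψ u = 0 := hΨ.eq_zero_of_apply_eq (congrArg Ψ hu3).symm
    rw [hu4, map_zero] at hu3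
    have hu5 : (u : L1 m) = 0 := congrArg Subtype.val hu3
    exact Subtype.ext hu5
  · intro f
    obtain ⟨g, hg⟩ := hΨ.exists_sub_apply_eq (Ψ (resA0 A Ψ₀ lam f))
    set u := resA0 A Ψ₀ lam f + dirichlet A Ψ₀ lam g with hu
    -- This puts `g` in the range of `Ψ`, where `Ψ(lam)` is known to invert `Ψ₀`.
    have hg' : Ψ u = g := by
      rw [hu, map_add, ← hg]
      exact sub_add_cancel _ _
    have hu0 : Ψ₀ u = Ψ u := by
      have h1 : Ψ₀ u = Ψ₀ (dirichlet A Ψ₀ lam g) := by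
        rw [hu, map_add, h.Psi0_resA0, zero_add]
      rw [h1, ← hg', h.Psi0_dirichlet_Psi]
    obtain ⟨x, hx⟩ := exists_inclKer_eq (T := A) (Φ := Ψ₀ - Ψ) (sub_eq_zero.2 hu0)
    refine ⟨x, ?_⟩
    have h1 := shift_inclKer A (Ψ₀ - Ψ) lam x
    rw [hx, hu, map_add, h.shift_resA0, h.shift_dirichlet, add_zero] at h1
    exact h1.symm

theorem exists_shift_sub_eq (hΨ : PowersTendToZero (opPsiPsi A Ψ₀ Ψ lam))
    (hB : PowersTendToZero (opBRPsi A B Ψ₀ Ψ lam)) (f : L1 m) :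
    ∃ u : A.domain, Ψ₀ u = Ψ u ∧ shift A lam u - B u = f := by
  obtain ⟨k, hk⟩ := hB.exists_sub_apply_eq f
  refine ⟨resAPsi A Ψ₀ Ψ lam k, sub_eq_zero.1 (apply_inclKer A (Ψ₀ - Ψ) _), ?_⟩
  rw [← hk]
  exact congrArg (· - B (resAPsi A Ψ₀ Ψ lam k))
    (shift_resolvent _ _ (h.bijective_shift_opAPsi hΨ) k)

theorem isStochasticSemigroup_and_isGenerator {P : ℝ≥0 → L1 m →L[ℝ] L1 m}
    (hP : IsPerturbedSemigroup A B Ψ₀ Ψ P) (hΨ : PowersTendToZero (opPsiPsi A Ψ₀ Ψ lam))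
    (hB : PowersTendToZero (opBRPsi A B Ψ₀ Ψ lam)) :
    IsStochasticSemigroup P ∧ IsGenerator P (opAPsiB A B Ψ₀ Ψ) := by
  have hlap := fun f => hP.laplace_eq h f
  obtain ⟨hS, G, hG, hle, -⟩ := hP
  constructor
  · rw [hS.isStochasticSemigroup_iff h.pos]
    intro f hf
    obtain ⟨u, hu, rfl⟩ := h.exists_shift_sub_eq hΨ hB f
    -- Positivity of `u` is what admits the mass balance; it holds because `u` is the perturbation
    -- series at `f ≥ 0`.
    have h0 : 0 ≤ (u : L1 m) := by
      rw [← h.kato_shift_sub hu]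
      exact h.kato_nonneg hf
    have h1 := h.norm_balance h0
    rw [hlap, h.kato_shift_sub hu, ← mass_eq_norm hf, map_sub, mass_eq_norm (h.B_nonneg u h0)]
    rw [hu, mass_eq_norm (h.Psi_nonneg u h0)] at h1
    linarith
  · intro f g
    refine ⟨fun hfg => (hG f g).1 (LinearPMap.le_graph_of_le hle hfg), fun hfg => ?_⟩
    -- Both `u` and `f` are the resolvent of the generator at `lam • f - g`, so they coincide and
    -- `f` lies in `D(A_Ψ)`.
    obtain ⟨u, hu, hy⟩ := h.exists_shift_sub_eq hΨ hB (lam • f - g)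
    have h1 : (u : L1 m) = f := by
      rw [← h.kato_shift_sub hu, hy, ← hlap]
      exact hS.isContractionSemigroup.laplace_of_hasOrbitDeriv h.pos hfg
    refine mem_graph_opAPsiB.2 ⟨u, hu, h1, ?_⟩
    rw [shift_apply, h1, sub_sub] at hy
    exact sub_right_injective hy

end IsAdmissible

end Admissible

end KatoGreiner

end

/-! ### The main theorem. -/

theorem corollary3p5
    {E E' : Type*} [MeasurableSpace E] [MeasurableSpace E']
    (m : Measure E) [SigmaFinite m] (m' : Measure E') [SigmaFinite m']
    (A : KatoGreiner.L1 m →ₗ.[ℝ] KatoGreiner.L1 m)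
    (B : A.domain →ₗ[ℝ] KatoGreiner.L1 m)
    (Ψ₀ Ψ : A.domain →ₗ[ℝ] KatoGreiner.L1 m')
    (hB : KatoGreiner.IsPositiveOn B)
    (hΨ₀ : KatoGreiner.IsPositiveOn Ψ₀)
    (hΨ : KatoGreiner.IsPositiveOn Ψ)
    -- without a boundary operator there is no boundary perturbation
    (hdeg : Ψ₀ = 0 → Ψ = 0)
    -- `A₀` generates a substochastic semigroup
    (hgen : ∃ S, KatoGreiner.IsSubstochasticSemigroup S ∧
      KatoGreiner.IsGenerator S (KatoGreiner.opA0 A Ψ₀))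
    -- positive right inverses
    (hinv : Ψ₀ ≠ 0 → ∀ lam : ℝ, 0 < lam →
      ∃ Φ, KatoGreiner.IsPositiveRightInverse A Ψ₀ lam Φ)
    -- equality in the mass balance
    (hmass : ∀ f : A.domain, 0 ≤ (f : KatoGreiner.L1 m) →
      (∫ x, (A f + B f) x ∂m) + (∫ x, (Ψ f - Ψ₀ f) x ∂m') = 0) :
    (∃ P, KatoGreiner.IsPerturbedSemigroup A B Ψ₀ Ψ P) ∧
    ∀ P, KatoGreiner.IsPerturbedSemigroup A B Ψ₀ Ψ P →
      (KatoGreiner.IsStochasticSemigroup P ↔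
        ∃ lam : ℝ, 0 < lam ∧ ∀ f : KatoGreiner.L1 m, 0 ≤ f →
          Tendsto (fun n : ℕ =>
            KatoGreiner.sumNorm ((KatoGreiner.calBR A B Ψ₀ Ψ lam ^ n) (f, 0)))
            atTop (𝓝 0)) ∧
      ((∃ lam : ℝ, 0 < lam ∧
          KatoGreiner.PowersTendToZero (KatoGreiner.opPsiPsi A Ψ₀ Ψ lam) ∧
          KatoGreiner.PowersTendToZero (KatoGreiner.opBRPsi A B Ψ₀ Ψ lam)) →
        KatoGreiner.IsStochasticSemigroup P ∧
          KatoGreiner.IsGenerator P (KatoGreiner.opAPsiB A B Ψ₀ Ψ)) := by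
  obtain ⟨S, hS, hG⟩ := hgen
  have h : ∀ ⦃lam : ℝ⦄, 0 < lam → KatoGreiner.IsAdmissible A B Ψ₀ Ψ lam := fun lam hlam =>
    KatoGreiner.isAdmissible_of_generator hB hΨ hdeg hS hG hinv hmass hlam
  refine ⟨KatoGreiner.exists_isPerturbedSemigroup h fun f => ?_,
    fun P hP => ⟨⟨fun hst => ?_, ?_⟩, ?_⟩⟩
  · refine (hS.isContractionSemigroup.tendsto_smul_laplace f).congr' ?_
    filter_upwards [eventually_gt_atTop 0] with lam hlam
    rw [KatoGreiner.coe_resA0_eq_laplace hS hG hlam]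
  · exact ⟨1, one_pos, ((h one_pos).isStochasticSemigroup_iff hP).1 hst⟩
  · rintro ⟨lam, hlam, hcal⟩
    exact ((h hlam).isStochasticSemigroup_iff hP).2 hcal
  · rintro ⟨lam, hlam, hΨΨ, hBR⟩
    exact (h hlam).isStochasticSemigroup_and_isGenerator hP hΨΨ hBR
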